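/- Let $x\in\mathbb R^n$. Count-Sketch with $R\ge 1$ rows and $C\geq 1$ columns uses fully random hash functions: $h_u:[n]\to[C]$ and $s_u:[n]\to\{\pm1\}$ for $u\in[R]$, all values being independent and uniform. It computes $y_{u,v}=\sum_{i:\,h_u(i)=v}s_u(i)x_i$ and the estimate $\widehat x\in\mathbb R^n$ given by $\widehat x_i=\operatorname{median}_{u\in[R]} s_u(i)\,y_{u,h_u(i)}$ (the median of an even number of reals is the average of the two middle ones). For $S\subseteq[n]$, $x_S$ denotes $x$ with the coordinates outside $S$ replaced by $0$, and $x_{\mathrm{tail}(k)}$ denotes $x$ with its $k$ largest coordinates in absolute value replaced by $0$. For every real constant $d$ and every constant $A>0$ there are constants $c_0>0$ and $K>0$, depending only on $d$ and $A$, such that the following holds for all real $c\ge c_0$ and all integers $n\ge 0$, $k\ge 1$, $R\ge 1$ with $R\ge A\log k$ and $C=ck$ an integer. For every $x\in\mathbb R^n$ and every set $S\subseteq[n]$ with $1\le|S|\le k$, $$\Pr\left[\|\widehat x_S-x_S\|_2^2>|S|\cdot\frac1R\cdot\frac{\|x_{\mathrm{tail}(k)}\|_2^2}{k}\right]\le\frac{K}{|S|^d}.$$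 (For $S=\emptyset$ the event is empty.) -/

import Mathlib

noncomputable section

namespace CountSketch

/-- The median of a finite family of reals: the middle value of the sorted family when `R` is odd,
the average of the two middle values when `R` is even (and `0` for the empty family). -/
def median {R : ℕ} (a : Fin R → ℝ) : ℝ :=
  if h : 0 < R then
    (a (Tuple.sort a ⟨(R - 1) / 2, by omega⟩) + a (Tuple.sort a ⟨R / 2, by omega⟩)) / 2
  else 0

/-- The hash functions `h_u : [n] → [C]` and `s_u : [n] → {±1}` of all rows `u ∈ [R]`. -/
abbrev Hashes (R n C : ℕ) : Type :=
  (Fin R → Fin n → Fin C) × (Fin R → Fin n → ℤˣ)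

instance : MeasurableSingletonClass ℤˣ where
  measurableSet_singleton a :=
    ⟨{(a : ℤ)}, MeasurableSet.singleton _, by ext b; simp [Units.ext_iff]⟩

/-- The sketch `y_{u,v} = ∑_{i : h_u(i) = v} s_u(i) x_i`. -/
def sketch {R n C : ℕ} (ω : Hashes R n C) (x : EuclideanSpace ℝ (Fin n))
    (u : Fin R) (v : Fin C) : ℝ :=
  ∑ i with ω.1 u i = v, ((ω.2 u i : ℤ) : ℝ) * x i

/-- The estimate `x̂_i = median_u s_u(i) y_{u, h_u(i)}`, computed from the sketch. -/
def estimate {R n C : ℕ} (ω : Hashes R n C) (x : EuclideanSpace ℝ (Fin n)) :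
    EuclideanSpace ℝ (Fin n) :=
  WithLp.toLp 2 fun i => median fun u => ((ω.2 u i : ℤ) : ℝ) * sketch ω x u (ω.1 u i)

/-- Fully random hash functions: the uniform distribution on all choices of `(h_u, s_u)_u`. -/
def hashMeasure (R n C : ℕ) : MeasureTheory.Measure (Hashes R n C) :=
  ProbabilityTheory.uniformOn Set.univ

theorem isProbabilityMeasure_hashMeasure {R n C : ℕ} (hC : 0 < C) :
    MeasureTheory.IsProbabilityMeasure (hashMeasure R n C) := by
  have : Nonempty (Fin C) := ⟨⟨0, hC⟩⟩
  exact ProbabilityTheory.isProbabilityMeasure_uniformOn Set.finite_univ Set.univ_nonempty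

/-- The rank of coordinate `i` (starting at `0`) when the coordinates are listed by decreasing
absolute value, ties being broken by index. -/
def rank {n : ℕ} (x : EuclideanSpace ℝ (Fin n)) (i : Fin n) : ℕ :=
  ((Tuple.sort fun j => -|x j|).symm i : ℕ)

/-- `x` with its `k` largest coordinates (in absolute value) replaced by `0`. -/
def tail {n : ℕ} (x : EuclideanSpace ℝ (Fin n)) (k : ℕ) : EuclideanSpace ℝ (Fin n) :=
  WithLp.toLp 2 fun i => if rank x i < k then 0 else x i

/-- `x_S`: the coordinates outside `S` are replaced by `0`. -/
def restrict {n : ℕ} (S : Finset (Fin n)) (x : EuclideanSpace ℝ (Fin n)) :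
    EuclideanSpace ℝ (Fin n) :=
  WithLp.toLp 2 fun i => if i ∈ S then x i else 0

end CountSketch

end

/-!
Fix a threshold `τ`. The error of the median at coordinate `i` exceeds `τ` only if at least half of
the rows vote for it, and the rows are independent. Write `σ² = ‖x_tail(k)‖² / C`.

*One vote.* In one row the error of coordinate `i` is a symmetric variable: its sign times the
content `W` of its bucket. So the vote is `+1` with probability at most `1/2`, with a deficit
proportional to `P(|W| ≤ τ)`. Since `W` is a sum of lazy signs, it is the difference of two
independent copies of a sum of Bernoulli variables, and a pigeonhole argument gives
`P(|W| ≤ τ) ≳ τ / σ` for all `τ ≤ σ` (`smallBall`); the `k` large coordinates are harmless because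
they all miss the bucket with constant probability. By Chernoff's method, an error above
`√(t / R) σ`, up to constants, then has probability `exp (-Ω(t))`.

*Many coordinates.* These tail bounds hold jointly, as if the coordinates were independent, for
every set `I` of logarithmically many coordinates (`wexp_joint_le`). If the coordinates of `I` fall
into distinct buckets of a row, then the buckets are revealed one after the other: given the
earlier ones, the rest of the coordinates is spread uniformly over the other buckets, and the
small-ball estimate still applies (`wexp_prod_buckets`). A collision inside `I` is so unlikely that
a crude second-order bound suffices (`wexp_votes_le`, `wexp_row_le`).

*Concentration.* Joint tails for all `I ⊆ S` with `q = ⌈d log |S|⌉` elements bound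
`E exp (∑_{i ∈ I} Z i)` by `4 ^ q`, where `Z i` is the squared error in units of a large constant
times `σ² / R`, rounded down and truncated at a small multiple of `R`. Jensen's inequality over all
such `I` shows that the average of `Z` over `S` is at most `3` up to probability `exp (-q) ≤ |S| ^ (-d)`
(`wexp_sum_sq_le`). That some error of `S` is beyond the truncation has probability at most
`|S| (2 β) ^ R`, where `β` can be made as small as desired by increasing the unit and `c`
(`wexp_medianError_le`); this is where `R ≥ A log k` is needed.

Expectations are finite weighted sums `wexp w Φ`, for independent coordinates with common law `w`.
-/

namespace CountSketch
open Finset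

/-! ### Expectations over independent coordinates -/

/-- The expectation of `Φ g` when the coordinates of `g : ι → α` are independent with law `w`. -/
noncomputable def wexp {ι α : Type*} [Fintype ι] [DecidableEq ι] [Fintype α] (w : α → ℝ)
    (Φ : (ι → α) → ℝ) : ℝ :=
  ∑ g, (∏ j, w (g j)) * Φ g

section wexp

variable {ι α β : Type*} [Fintype ι] [DecidableEq ι] [Fintype α] [Fintype β]
  {w : α → ℝ} {v : β → ℝ} {Φ Ψ : (ι → α) → ℝ}

theorem wexp_mono (hw : ∀ a, 0 ≤ w a) (h : ∀ g, (∀ j, w (g j) ≠ 0) → Φ g ≤ Ψ g) :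
    wexp w Φ ≤ wexp w Ψ := by
  refine sum_le_sum fun g _ => ?_
  by_cases hg : ∀ j, w (g j) ≠ 0
  · exact mul_le_mul_of_nonneg_left (h g hg) (prod_nonneg fun _ _ => hw _)
  · push Not at hg
    obtain ⟨j, hj⟩ := hg
    have : ∏ j, w (g j) = 0 := prod_eq_zero (mem_univ j) hj
    simp [this]

theorem wexp_congr (h : ∀ g, (∀ j, w (g j) ≠ 0) → Φ g = Ψ g) : wexp w Φ = wexp w Ψ := by
  refine sum_congr rfl fun g _ => ?_
  by_cases hg : ∀ j, w (g j) ≠ 0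
  · rw [h g hg]
  · push Not at hg
    obtain ⟨j, hj⟩ := hg
    have : ∏ j, w (g j) = 0 := prod_eq_zero (mem_univ j) hj
    simp [this]

theorem wexp_prod (w : α → ℝ) (f : ι → α → ℝ) :
    wexp w (fun g => ∏ j, f j (g j)) = ∏ j, ∑ a, w a * f j a := by
  classical
  simp only [wexp, ← prod_mul_distrib]
  rw [prod_univ_sum]
  simp

theorem wexp_const (hw : w ∈ stdSimplex ℝ α) (c : ℝ) : wexp (ι := ι) w (fun _ => c) = c := by
  have h := wexp_prod (ι := ι) w (fun _ _ => 1)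
  simp only [prod_const_one, mul_one, hw.2] at h
  have h1 : ∑ g : ι → α, ∏ j, w (g j) = 1 := by simpa [wexp] using h
  rw [wexp, ← sum_mul, h1, one_mul]

theorem wexp_add (w : α → ℝ) (Φ Ψ : (ι → α) → ℝ) :
    wexp w (fun g => Φ g + Ψ g) = wexp w Φ + wexp w Ψ := by
  simp [wexp, mul_add, sum_add_distrib]

theorem wexp_const_mul (w : α → ℝ) (c : ℝ) (Φ : (ι → α) → ℝ) :
    wexp w (fun g => c * Φ g) = c * wexp w Φ := by
  simp only [wexp, mul_sum]
  exact sum_congr rfl fun g _ => by ring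

theorem wexp_sum {κ : Type*} (s : Finset κ) (w : α → ℝ) (Φ : κ → (ι → α) → ℝ) :
    wexp w (fun g => ∑ k ∈ s, Φ k g) = ∑ k ∈ s, wexp w (Φ k) := by
  simp only [wexp, mul_sum]
  exact sum_comm

theorem wexp_nonneg (hw : ∀ a, 0 ≤ w a) (h : ∀ g, 0 ≤ Φ g) : 0 ≤ wexp w Φ :=
  sum_nonneg fun g _ => mul_nonneg (prod_nonneg fun _ _ => hw _) (h g)

theorem wexp_le_const (hw : w ∈ stdSimplex ℝ α) {c : ℝ} (h : ∀ g, Φ g ≤ c) : wexp w Φ ≤ c :=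
  (wexp_mono hw.1 fun g _ => h g).trans_eq (wexp_const hw c)

/-- Change of variables: `v` is the image of the law `w` under each of the maps `φ j`. -/
theorem wexp_map [DecidableEq β] (φ : ι → α → β) (h : ∀ j b, ∑ a with φ j a = b, w a = v b)
    (Φ : (ι → β) → ℝ) : wexp w (fun g => Φ fun j => φ j (g j)) = wexp v Φ := by
  classical
  simp only [wexp]
  rw [← sum_fiberwise univ (fun (g : ι → α) j => φ j (g j))]
  refine sum_congr rfl fun b _ => ?_
  have : ∏ j, v (b j) = ∑ g : ι → α with (fun j => φ j (g j)) = b, ∏ j, w (g j) := by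
    have h' : ∀ j, v (b j) = ∑ a with φ j a = b j, w a := fun j => (h j _).symm
    simp only [h', prod_univ_sum]
    refine sum_congr ?_ fun _ _ => rfl
    ext g
    simp [Fintype.mem_piFinset, funext_iff]
  rw [this, sum_mul]
  refine sum_congr rfl fun g hg => ?_
  rw [(mem_filter.1 hg).2]

theorem wexp_pair (w : α → ℝ) (v : β → ℝ) (Φ : (ι → α × β) → ℝ) :
    wexp (fun p : α × β => w p.1 * v p.2) Φ =
      wexp w fun g => wexp v fun g' => Φ fun j => (g j, g' j) := by
  simp only [wexp, mul_sum]
  rw [← Fintype.sum_prod_type',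
    ← (Equiv.arrowProdEquivProdArrow ι (fun _ => α) (fun _ => β)).sum_comp]
  refine sum_congr rfl fun g _ => ?_
  simp [Equiv.arrowProdEquivProdArrow, prod_mul_distrib, mul_assoc]

/-- The coordinates of the whole family have the product law. -/
theorem pi_mem_stdSimplex (hw : w ∈ stdSimplex ℝ α) :
    (fun g : ι → α => ∏ j, w (g j)) ∈ stdSimplex ℝ (ι → α) := by
  refine ⟨fun g => prod_nonneg fun _ _ => hw.1 _, ?_⟩
  simpa [wexp] using wexp_const (ι := ι) hw 1

theorem wexp_coord (hw : w ∈ stdSimplex ℝ α) (i : ι) (f : α → ℝ) :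
    wexp w (fun g => f (g i)) = ∑ a, w a * f a := by
  have h := wexp_prod w (fun j a => if j = i then f a else 1)
  simp only [prod_ite_eq', mem_univ, if_true] at h
  rw [h, ← Finset.mul_prod_erase univ _ (mem_univ i)]
  rw [prod_eq_one, mul_one]
  · simp
  · intro j hj
    simp [(mem_erase.1 hj).1, hw.2]

theorem wexp_coord_mul (hw : w ∈ stdSimplex ℝ α) {i k : ι} (hik : i ≠ k) (f f' : α → ℝ) :
    wexp w (fun g => f (g i) * f' (g k)) = (∑ a, w a * f a) * ∑ a, w a * f' a := by
  have h := wexp_prod w (fun j a => (if j = i then f a else 1) * (if j = k then f' a else 1))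
  simp only [prod_mul_distrib, prod_ite_eq', mem_univ, if_true] at h
  rw [h, ← Finset.mul_prod_erase univ _ (mem_univ i),
    ← Finset.mul_prod_erase _ _ (mem_erase.2 ⟨hik.symm, mem_univ k⟩)]
  rw [prod_eq_one, mul_one]
  · simp [hik, hik.symm]
  · intro j hj
    simp only [mem_erase] at hj
    simp [hj.1, hj.2.1, hw.2]

/-- The second moment of a sum of independent centred variables. -/
theorem wexp_sq_sum (hw : w ∈ stdSimplex ℝ α) (X : α → ℝ) (hX : ∑ a, w a * X a = 0) (y : ι → ℝ) :
    wexp w (fun g => (∑ j, y j * X (g j)) ^ 2) = (∑ j, y j ^ 2) * ∑ a, w a * X a ^ 2 := by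
  have h1 : ∀ g : ι → α, (∑ j, y j * X (g j)) ^ 2 =
      ∑ i, ∑ j, (y i * y j) * (X (g i) * X (g j)) := fun g => by
    rw [sq, sum_mul_sum]
    exact sum_congr rfl fun i _ => sum_congr rfl fun j _ => by ring
  simp only [h1, wexp_sum, wexp_const_mul]
  rw [sum_mul]
  refine sum_congr rfl fun i _ => ?_
  rw [Finset.sum_eq_single i]
  · have := wexp_coord hw i (fun a => X a ^ 2)
    simp only [sq] at this ⊢
    rw [this]
  · intro j _ hj
    rw [wexp_coord_mul hw hj.symm, hX]
    simp
  · simp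

/-- Redrawing the coordinates outside `p` does not change an expectation. -/
theorem wexp_resample [DecidableEq α] (hw : w ∈ stdSimplex ℝ α) (p : ι → Prop) [DecidablePred p]
    (Φ : (ι → α) → ℝ) :
    wexp w Φ = wexp w fun g => wexp w fun g' => Φ fun j => if p j then g j else g' j := by
  rw [← wexp_pair w w (fun g => Φ fun j => if p j then (g j).1 else (g j).2)]
  refine (wexp_map (fun j (a : α × α) => if p j then a.1 else a.2) (fun j b => ?_) Φ).symm
  rw [sum_filter, Fintype.sum_prod_type]
  by_cases hj : p j
  · simp only [hj, if_true]
    rw [Finset.sum_eq_single b (fun a _ ha => by simp [ha]) (by simp)]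
    simp [← mul_sum, hw.2]
  · simp only [hj, if_false]
    simp [← sum_mul, hw.2]

end wexp

/-! ### Small-ball probability of one bucket -/

theorem exists_block (N : ℕ) (hN : 1 ≤ N) {x τ : ℝ} (hx : 0 ≤ x) (hxN : x ≤ τ * N) :
    ∃ k ∈ range N, k * τ ≤ x ∧ x ≤ (k + 1) * τ := by
  classical
  have hex : ∃ k : ℕ, x ≤ (k + 1) * τ := ⟨N - 1, by
    rw [Nat.cast_sub hN]; push_cast; linarith⟩
  refine ⟨Nat.find hex, ?_, ?_, Nat.find_spec hex⟩
  · have : Nat.find hex ≤ N - 1 := Nat.find_min' hex (by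
      rw [Nat.cast_sub hN]; push_cast; linarith)
    rw [mem_range]; omega
  · rcases Nat.eq_zero_or_pos (Nat.find hex) with h0 | h0
    · simp [h0, hx]
    · have h := Nat.find_min hex (Nat.sub_lt h0 one_pos)
      rw [Nat.cast_sub (m := 1) h0] at h
      push_cast at h
      rw [sub_add_cancel] at h
      exact (not_le.1 h).le

/-- The Bernoulli law with success probability `a`. -/
def bernoulliLaw (a : ℝ) (t : Bool) : ℝ := if t then a else 1 - a

theorem bernoulliLaw_mem {a : ℝ} (h0 : 0 ≤ a) (h1 : a ≤ 1) :
    bernoulliLaw a ∈ stdSimplex ℝ Bool := by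
  refine ⟨fun t => ?_, by simp [bernoulliLaw]⟩
  cases t <;> simp [bernoulliLaw, h0, h1]

/-- A Bernoulli-weighted sum lies within two standard deviations of the mean of its part outside
`H` with probability at least one half, provided that `H` is unlikely to be hit at all. -/
theorem half_le_wexp_bernoulli {ι : Type*} [Fintype ι] [DecidableEq ι] {a : ℝ} (ha0 : 0 < a)
    (ha1 : a < 1) (y : ι → ℝ) (H : Finset ι) (hH : a * #H ≤ 1 / 4) {σ : ℝ} (hσ : 0 ≤ σ)
    (hvar : a * (1 - a) * ∑ j with j ∉ H, y j ^ 2 ≤ σ ^ 2) :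
    1 / 2 ≤ wexp (bernoulliLaw a) fun η =>
      if |∑ j, (if η j then y j else 0) - a * ∑ j with j ∉ H, y j| ≤ 2 * σ then (1 : ℝ) else 0 := by
  have hlaw := bernoulliLaw_mem ha0.le ha1.le
  set m := a * ∑ j with j ∉ H, y j with hm
  set z : ι → ℝ := fun j => if j ∈ H then 0 else y j with hz
  set X : Bool → ℝ := fun t => (if t then 1 else 0) - a with hX
  have hsq : wexp (bernoulliLaw a) (fun η => (∑ j, z j * X (η j)) ^ 2) ≤ σ ^ 2 := by
    rw [wexp_sq_sum hlaw X (by simp [bernoulliLaw, hX]; ring)]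
    have h1 : ∑ j, z j ^ 2 = ∑ j with j ∉ H, y j ^ 2 := by
      rw [sum_filter]
      refine sum_congr rfl fun j _ => ?_
      by_cases hj : j ∈ H <;> simp [hz, hj]
    have h2 : ∑ t, bernoulliLaw a t * X t ^ 2 = a * (1 - a) := by
      simp [bernoulliLaw, hX]; ring
    rw [h1, h2, mul_comm]
    exact hvar
  -- Chebyshev's inequality, including the degenerate case `σ = 0`
  have hcheb : wexp (bernoulliLaw a)
      (fun η => if 2 * σ < |∑ j, z j * X (η j)| then (1 : ℝ) else 0) ≤ 1 / 4 := by
    rcases hσ.eq_or_lt with h0 | hpos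
    · subst h0
      have hz0 : ∀ j, z j = 0 := by
        intro j
        by_cases hj : j ∈ H
        · simp [hz, hj]
        · have hnn : 0 ≤ ∑ j with j ∉ H, y j ^ 2 := sum_nonneg fun _ _ => sq_nonneg _
          have hpos : 0 < a * (1 - a) := mul_pos ha0 (by linarith)
          have hs0 : ∑ j with j ∉ H, y j ^ 2 = 0 := by
            apply le_antisymm _ hnn
            by_contra hcon
            have := mul_pos hpos (not_le.1 hcon)
            linarith
          have := (sum_eq_zero_iff_of_nonneg (fun _ _ => sq_nonneg _)).1 hs0 j (by simp [hj])
          simp [hz, hj, pow_eq_zero_iff (two_ne_zero)] at this ⊢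
          exact this
      refine wexp_le_const hlaw fun η => ?_
      simp [hz0]
    · have hle : ∀ η : ι → Bool, (if 2 * σ < |∑ j, z j * X (η j)| then (1 : ℝ) else 0) ≤
          (1 / (4 * σ ^ 2)) * (∑ j, z j * X (η j)) ^ 2 := by
        intro η
        split_ifs with h
        · rw [one_div_mul_eq_div, one_le_div (by positivity), ← sq_abs (∑ j, z j * X (η j))]
          nlinarith
        · positivity
      refine (wexp_mono hlaw.1 fun η _ => hle η).trans ?_
      rw [wexp_const_mul, one_div_mul_eq_div, div_le_iff₀ (by positivity)]
      linarith
  have hhit : wexp (bernoulliLaw a) (fun η => ∑ j ∈ H, if η j then (1 : ℝ) else 0) ≤ 1 / 4 := by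
    rw [wexp_sum]
    have : ∀ j ∈ H, wexp (bernoulliLaw a) (fun η : ι → Bool => if η j then (1 : ℝ) else 0) = a := by
      intro j _
      rw [wexp_coord hlaw j (fun t => if t then (1 : ℝ) else 0)]
      simp [bernoulliLaw]
    rw [sum_congr rfl this, sum_const, nsmul_eq_mul]
    linarith
  have key : ∀ η : ι → Bool, (1 : ℝ) ≤
      (if |∑ j, (if η j then y j else 0) - m| ≤ 2 * σ then (1 : ℝ) else 0) +
        ((if 2 * σ < |∑ j, z j * X (η j)| then (1 : ℝ) else 0) +
          ∑ j ∈ H, if η j then (1 : ℝ) else 0) := by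
    intro η
    have hnn : 0 ≤ ∑ j ∈ H, if η j then (1 : ℝ) else 0 :=
      sum_nonneg fun j _ => by split_ifs <;> norm_num
    by_cases hex : ∃ j ∈ H, η j = true
    · obtain ⟨j, hj, hjt⟩ := hex
      have h1 : (1 : ℝ) ≤ ∑ j ∈ H, if η j then (1 : ℝ) else 0 := by
        have := single_le_sum (f := fun j => if η j then (1 : ℝ) else 0)
          (fun j _ => by split_ifs <;> norm_num) hj
        simpa [hjt] using this
      split_ifs <;> linarith
    · push Not at hex
      have heq : ∑ j, z j * X (η j) = ∑ j, (if η j then y j else 0) - m := by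
        rw [hm, mul_sum, sum_filter, ← sum_sub_distrib]
        refine sum_congr rfl fun j _ => ?_
        by_cases hj : j ∈ H
        · simp [hz, hj, hex j hj]
        · by_cases ht : η j = true <;> simp [hz, hj, hX, ht] <;> ring
      rw [heq]
      split_ifs with h1 h2 <;> linarith
  have := wexp_mono (ι := ι) hlaw.1 fun η _ => key η
  rw [wexp_const hlaw, wexp_add, wexp_add] at this
  linarith

/-- The difference of two independent copies of a variable which lies in an interval of length
`4 * σ ≤ τ * N` with probability at least one half is at most `τ` in absolute value with
probability at least `1 / (4 * N)`: cut the interval into `N` blocks of length `τ`. -/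
theorem pigeonhole_diff {ι α : Type*} [Fintype ι] [DecidableEq ι] [Fintype α] {w : α → ℝ}
    (hw : w ∈ stdSimplex ℝ α) (U : (ι → α) → ℝ) {m σ τ : ℝ} {N : ℕ} (hN : 1 ≤ N)
    (hτ : 4 * σ ≤ τ * N)
    (hU : 1 / 2 ≤ wexp w fun η => if |U η - m| ≤ 2 * σ then (1 : ℝ) else 0) :
    1 / (4 * N : ℝ) ≤
      wexp w fun η => wexp w fun η' => if |U η - U η'| ≤ τ then (1 : ℝ) else 0 := by
  classical
  have hblock : ∀ η : ι → α, ∃ k, |U η - m| ≤ 2 * σ →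
      k ∈ range N ∧ k * τ ≤ U η - m + 2 * σ ∧ U η - m + 2 * σ ≤ (k + 1) * τ := by
    intro η
    by_cases h : |U η - m| ≤ 2 * σ
    · obtain ⟨k, hk⟩ := exists_block N hN (x := U η - m + 2 * σ) (τ := τ)
        (by linarith [(abs_le.1 h).1]) (by linarith [(abs_le.1 h).2])
      exact ⟨k, fun _ => hk⟩
    · exact ⟨0, fun h' => absurd h' h⟩
  choose k hk using hblock
  set F : ℕ → (ι → α) → ℝ := fun l η => if |U η - m| ≤ 2 * σ ∧ k η = l then 1 else 0 with hF
  have hsum : 1 / 2 ≤ ∑ l ∈ range N, wexp w (F l) := by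
    rw [← wexp_sum]
    refine hU.trans (wexp_mono hw.1 fun η _ => ?_)
    by_cases h : |U η - m| ≤ 2 * σ
    · have : ∑ l ∈ range N, F l η = 1 := by
        simp only [hF, h, true_and]
        rw [Finset.sum_ite_eq]
        simp [(hk η h).1]
      rw [this, if_pos h]
    · rw [if_neg h]
      exact sum_nonneg fun l _ => by simp only [hF]; split_ifs <;> norm_num
  have hcs : (∑ l ∈ range N, wexp w (F l)) ^ 2 ≤ N * ∑ l ∈ range N, wexp w (F l) ^ 2 := by
    simpa using sq_sum_le_card_mul_sum_sq (s := range N) (f := fun l => wexp w (F l))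
  have hle : ∑ l ∈ range N, wexp w (F l) ^ 2 ≤
      wexp w fun η => wexp w fun η' => if |U η - U η'| ≤ τ then (1 : ℝ) else 0 := by
    have h1 : ∑ l ∈ range N, wexp w (F l) ^ 2 =
        wexp w fun η => wexp w fun η' => ∑ l ∈ range N, F l η * F l η' := by
      simp only [wexp_sum, wexp_const_mul]
      refine sum_congr rfl fun l _ => ?_
      rw [sq, ← wexp_const_mul]
      refine wexp_congr fun η _ => ?_
      ring
    rw [h1]
    refine wexp_mono hw.1 fun η _ => wexp_mono hw.1 fun η' _ => ?_
    by_cases hh : |U η - m| ≤ 2 * σ ∧ |U η' - m| ≤ 2 * σ ∧ k η = k η'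
    · obtain ⟨ha, hb, hc⟩ := hh
      have h2 : ∑ l ∈ range N, F l η * F l η' ≤ 1 := by
        simp only [hF, ha, hb, true_and, ← hc, mul_ite, mul_one, mul_zero]
        rw [Finset.sum_congr rfl (g := fun l => if k η = l then (1 : ℝ) else 0)
          (fun l _ => by split_ifs <;> rfl), Finset.sum_ite_eq]
        split_ifs <;> norm_num
      have h3 : |U η - U η'| ≤ τ := by
        obtain ⟨-, h4, h5⟩ := hk η ha
        obtain ⟨-, h6, h7⟩ := hk η' hb
        rw [← hc] at h6 h7
        rw [abs_le]
        constructor <;> linarith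
      rw [if_pos h3]
      exact h2
    · have h2 : ∑ l ∈ range N, F l η * F l η' = 0 := by
        refine sum_eq_zero fun l _ => ?_
        by_contra hne
        refine hh ⟨?_, ?_, ?_⟩
        · by_contra hc; simp [hF, hc] at hne
        · by_contra hc; simp [hF, hc] at hne
        · by_contra hc
          by_cases hl : k η = l
          · have : k η' ≠ l := fun h => hc (hl.trans h.symm)
            simp [hF, this] at hne
          · simp [hF, hl] at hne
      rw [h2]
      split_ifs <;> norm_num
  have hNpos : (0 : ℝ) < N := by exact_mod_cast hN
  rw [div_le_iff₀ (by positivity)]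
  nlinarith

/-- The law of the pair (bucket, sign) of one coordinate when the bucket is uniform in `V`. -/
noncomputable def bucketLaw {C : ℕ} (V : Finset (Fin C)) (a : Fin C × ℤˣ) : ℝ :=
  if a.1 ∈ V then 1 / (2 * #V) else 0

/-- The signed content of bucket `b` for the weights `y` and the hash values `g` of one row. -/
def bucketSum {n C : ℕ} (b : Fin C) (y : Fin n → ℝ) (g : Fin n → Fin C × ℤˣ) : ℝ :=
  ∑ j, if (g j).1 = b then (((g j).2 : ℤ) : ℝ) * y j else 0

theorem sum_units {f : ℤˣ → ℝ} : ∑ s, f s = f 1 + f (-1) := by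
  have : (univ : Finset ℤˣ) = {1, -1} := rfl
  rw [this, sum_pair (by decide)]

theorem bucketLaw_mem {C : ℕ} {V : Finset (Fin C)} (hV : V.Nonempty) :
    bucketLaw V ∈ stdSimplex ℝ (Fin C × ℤˣ) := by
  refine ⟨fun a => by unfold bucketLaw; split_ifs <;> positivity, ?_⟩
  have : (0 : ℝ) < #V := by exact_mod_cast hV.card_pos
  rw [Fintype.sum_prod_type]
  simp only [bucketLaw, sum_units]
  simp only [← two_mul, ← mul_sum, Finset.sum_ite_mem, univ_inter, sum_const, nsmul_eq_mul]
  field_simp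

/-- The law of a sign which is `0` with probability `1 - 2 * κ`. -/
def lazyLaw (κ : ℝ) (t : SignType) : ℝ := if t = 0 then 1 - 2 * κ else κ

theorem wexp_bucketLaw_eq_lazy {n C : ℕ} {V : Finset (Fin C)} {b : Fin C} (hb : b ∈ V)
    (Φ : (Fin n → SignType) → ℝ) :
    wexp (bucketLaw V) (fun g => Φ fun j =>
      if (g j).1 = b then (if (g j).2 = 1 then 1 else -1) else 0) =
        wexp (lazyLaw (1 / (2 * #V))) Φ := by
  set φ : Fin C × ℤˣ → SignType := fun a => if a.1 = b then (if a.2 = 1 then 1 else -1) else 0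
    with hφ
  have h1 : ∑ a with φ a = 1, bucketLaw V a = 1 / (2 * #V) := by
    have : (univ.filter fun a => φ a = 1) = {(b, 1)} := by
      ext ⟨v, s⟩
      rcases Int.units_eq_one_or s with rfl | rfl <;> by_cases hv : v = b <;>
        simp [hφ, hv]
    rw [this, sum_singleton]
    simp [bucketLaw, hb]
  have h2 : ∑ a with φ a = -1, bucketLaw V a = 1 / (2 * #V) := by
    have : (univ.filter fun a => φ a = -1) = {(b, -1)} := by
      ext ⟨v, s⟩
      rcases Int.units_eq_one_or s with rfl | rfl <;> by_cases hv : v = b <;>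
        simp [hφ, hv]
    rw [this, sum_singleton]
    simp [bucketLaw, hb]
  have h3 := sum_fiberwise univ φ (bucketLaw V)
  rw [(bucketLaw_mem ⟨b, hb⟩).2] at h3
  have hu : (univ : Finset SignType) = {0, -1, 1} := rfl
  rw [hu, sum_insert (by decide), sum_pair (by decide), h1, h2] at h3
  refine wexp_map (fun _ => φ) (fun _ t => ?_) Φ
  rcases t with _ | _ | _
  · change ∑ a with φ a = 0, _ = _
    simp only [lazyLaw]
    rw [if_pos (by rfl)]
    linarith
  · exact h2
  · exact h1

/-- A lazy sign is the difference of two independent Bernoulli variables. -/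
theorem wexp_bernoulli_eq_lazy {n : ℕ} (a : ℝ) (Φ : (Fin n → SignType) → ℝ) :
    wexp (bernoulliLaw a) (fun η => wexp (bernoulliLaw a) fun η' => Φ fun j =>
      if η j then (if η' j then 0 else 1) else (if η' j then -1 else 0)) =
        wexp (lazyLaw (a * (1 - a))) Φ := by
  rw [← wexp_pair (bernoulliLaw a) (bernoulliLaw a) (fun η => Φ fun j =>
      if (η j).1 then (if (η j).2 then 0 else 1) else (if (η j).2 then -1 else 0))]
  refine wexp_map (fun _ (p : Bool × Bool) =>
    if p.1 then (if p.2 then 0 else 1) else (if p.2 then -1 else 0)) (fun _ t => ?_) Φ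
  rw [sum_filter, Fintype.sum_prod_type]
  rcases t with _ | _ | _ <;> simp [bernoulliLaw, lazyLaw] <;> ring

theorem exists_bernoulli {κ : ℝ} (h0 : 0 < κ) (h1 : κ ≤ 1 / 4) :
    ∃ a, 0 < a ∧ a < 1 ∧ a ≤ 2 * κ ∧ a * (1 - a) = κ := by
  have hs := Real.sq_sqrt (show 0 ≤ 1 - 4 * κ by linarith)
  have hs0 := Real.sqrt_nonneg (1 - 4 * κ)
  have hs1 : Real.sqrt (1 - 4 * κ) < 1 := by nlinarith
  exact ⟨(1 - Real.sqrt (1 - 4 * κ)) / 2, by linarith, by linarith, by nlinarith, by nlinarith⟩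

/-- The content of a bucket is concentrated near `0`, at every scale `τ` below its standard
deviation `σ`. A set `H` of arbitrarily large weights may be excluded from `σ`, if it is small. -/
theorem smallBall {n C : ℕ} {V : Finset (Fin C)} {b : Fin C} (hb : b ∈ V) (hV : 2 ≤ #V)
    (y : Fin n → ℝ) (H : Finset (Fin n)) (hH : 4 * #H ≤ #V) {σ τ : ℝ} (hσ : 0 ≤ σ) {N : ℕ}
    (hN : 1 ≤ N) (hvar : 1 / (2 * #V) * ∑ j with j ∉ H, y j ^ 2 ≤ σ ^ 2) (hτ : 4 * σ ≤ τ * N) :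
    1 / (4 * N : ℝ) ≤
      wexp (bucketLaw V) fun g => if |bucketSum b y g| ≤ τ then (1 : ℝ) else 0 := by
  have hVr : (2 : ℝ) ≤ #V := by exact_mod_cast hV
  have hHr : (4 : ℝ) * #H ≤ #V := by exact_mod_cast hH
  obtain ⟨a, ha0, ha1, ha2, hκ⟩ := exists_bernoulli (κ := 1 / (2 * #V)) (by positivity) (by
    rw [div_le_div_iff₀ (by positivity) (by norm_num)]; linarith)
  have haH : a * #H ≤ 1 / 4 := by
    have h1 : a * #H ≤ 2 * (1 / (2 * #V)) * (#V / 4) := by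
      apply mul_le_mul ha2 (by linarith) (by positivity) (by positivity)
    have h2 : 2 * (1 / (2 * #V)) * (#V / 4 : ℝ) = 1 / 4 := by field_simp
    linarith
  have h := pigeonhole_diff (bernoulliLaw_mem ha0.le ha1.le)
    (fun η => ∑ j : Fin n, if η j then y j else 0) hN hτ
    (half_le_wexp_bernoulli ha0 ha1 y H haH hσ (by rw [hκ]; exact hvar))
  refine h.trans_eq ?_
  have h1 := wexp_bernoulli_eq_lazy a
    (fun ζ : Fin n → SignType => if |∑ j, (ζ j : ℝ) * y j| ≤ τ then (1 : ℝ) else 0)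
  have h2 := wexp_bucketLaw_eq_lazy hb
    (fun ζ : Fin n → SignType => if |∑ j, (ζ j : ℝ) * y j| ≤ τ then (1 : ℝ) else 0)
  rw [hκ, ← h2] at h1
  have e1 : ∀ η η' : Fin n → Bool,
      (∑ j, if η j then y j else 0) - (∑ j, if η' j then y j else 0) =
        ∑ j, ((if η j then (if η' j then 0 else 1) else (if η' j then -1 else 0) : SignType) : ℝ)
          * y j := fun η η' => by
    rw [← sum_sub_distrib]
    refine sum_congr rfl fun j _ => ?_
    cases η j <;> cases η' j <;> simp
  have e2 : ∀ g : Fin n → Fin C × ℤˣ, bucketSum b y g =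
      ∑ j, ((if (g j).1 = b then (if (g j).2 = 1 then 1 else -1) else 0 : SignType) : ℝ) * y j :=
    fun g => by
      refine sum_congr rfl fun j _ => ?_
      rcases Int.units_eq_one_or (g j).2 with hs | hs <;> by_cases hv : (g j).1 = b <;>
        simp [hs, hv]
  simp only [e1, e2]
  exact h1

/-! ### Several buckets of one row -/

/-- A letter of law `bucketLaw V` can be drawn in two stages: first it is decided whether it falls
into the bucket `b`, and if not it is redrawn from the other buckets. -/
theorem wexp_bucketLaw_two_stage {n C : ℕ} {V : Finset (Fin C)} {b : Fin C} (hb : b ∈ V)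
    (hV : (V.erase b).Nonempty) (Φ : (Fin n → Fin C × ℤˣ) → ℝ) :
    wexp (bucketLaw V) Φ = wexp (bucketLaw V) fun g => wexp (bucketLaw (V.erase b)) fun g' =>
      Φ fun j => if (g j).1 = b then g j else g' j := by
  rw [← wexp_pair (bucketLaw V) (bucketLaw (V.erase b))
    (fun g => Φ fun j => if (g j).1.1 = b then (g j).1 else (g j).2)]
  refine (wexp_map (fun _ (p : (Fin C × ℤˣ) × (Fin C × ℤˣ)) => if p.1.1 = b then p.1 else p.2)
    (fun _ c => ?_) Φ).symm
  rw [sum_filter, Fintype.sum_prod_type]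
  have hv := (bucketLaw_mem hV).2
  have hpos : (0 : ℝ) < #(V.erase b) := by exact_mod_cast hV.card_pos
  have hcard : (#V : ℝ) = #(V.erase b) + 1 := by
    exact_mod_cast (card_erase_add_one hb).symm
  have hinner : ∀ a : Fin C × ℤˣ,
      (∑ a' : Fin C × ℤˣ, if (if a.1 = b then a else a') = c then
        bucketLaw V a * bucketLaw (V.erase b) a' else 0) =
      (if a = c then (if c.1 = b then bucketLaw V c else 0) else 0) +
        (if a.1 = b then 0 else bucketLaw V a) * bucketLaw (V.erase b) c := by
    intro a
    by_cases hab : a.1 = b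
    · by_cases hac : a = c
      · subst hac
        simp [hab, ← mul_sum, hv]
      · simp [hab, hac]
    · by_cases hac : a = c
      · subst hac
        simp [hab]
      · simp [hab, hac]
  have hout : ∑ a : Fin C × ℤˣ, (if a.1 = b then 0 else bucketLaw V a) =
      #(V.erase b) / (#(V.erase b) + 1) := by
    have h1 : ∀ a : Fin C × ℤˣ, (if a.1 = b then 0 else bucketLaw V a) =
        if a.1 ∈ V.erase b then 1 / (2 * #V : ℝ) else 0 := by
      intro a
      by_cases hab : a.1 = b <;> simp [hab, bucketLaw]
    rw [sum_congr rfl fun a _ => h1 a, Fintype.sum_prod_type]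
    simp only [sum_units, ← two_mul, ← mul_sum, Finset.sum_ite_mem, univ_inter, sum_const,
      nsmul_eq_mul]
    rw [hcard]
    field_simp
  simp only [hinner]
  rw [sum_add_distrib, ← sum_mul, hout]
  simp only [sum_ite_eq', mem_univ, if_true]
  by_cases hcb : c.1 = b
  · simp [hcb, bucketLaw]
  · by_cases hcV : c.1 ∈ V
    · simp only [hcb, bucketLaw, hcV, hcard]
      simp [hcb, hcV]
      field_simp
    · simp [hcb, bucketLaw, hcV]

/-- Functions of the contents of distinct buckets are dominated by independent ones: if each
`f i` has expectation at most `ρ i` whatever is left over for its bucket, then the expectation of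
their product is at most the product of the `ρ i`. -/
theorem wexp_prod_buckets {n C M : ℕ} {κ : Type*} [DecidableEq κ] (hM : 1 ≤ M) (x : Fin n → ℝ)
    (b : κ → Fin C) (f : κ → ℝ → ℝ) (ρ : κ → ℝ) (I : Finset κ)
    (hf : ∀ i ∈ I, ∀ z, 0 ≤ f i z)
    (hsingle : ∀ i ∈ I, ∀ V : Finset (Fin C), b i ∈ V → M ≤ #V → ∀ y : Fin n → ℝ,
      (∀ j, |y j| ≤ |x j|) →
        wexp (bucketLaw V) (fun g => f i (bucketSum (b i) y g)) ≤ ρ i) :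
    ∀ V : Finset (Fin C), (∀ i ∈ I, b i ∈ V) → Set.InjOn b I → M + #I ≤ #V →
      ∀ y : Fin n → ℝ, (∀ j, |y j| ≤ |x j|) →
        wexp (bucketLaw V) (fun g => ∏ i ∈ I, f i (bucketSum (b i) y g)) ≤ ∏ i ∈ I, ρ i := by
  induction I using Finset.induction_on with
  | empty =>
    intro V _ _ hV y _
    simp only [prod_empty]
    exact (wexp_const (bucketLaw_mem (card_pos.1 (by simp at hV; omega))) 1).le
  | insert i I hi ih =>
    intro V hbV hinj hV y hy
    rw [card_insert_of_notMem hi] at hV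
    have hb : b i ∈ V := hbV i (mem_insert_self _ _)
    have hcard := card_erase_add_one hb
    have hne : (V.erase (b i)).Nonempty := card_pos.1 (by omega)
    have hbI : ∀ k ∈ I, b k ≠ b i := fun k hk h =>
      hi (hinj (mem_insert_of_mem hk) (mem_insert_self _ _) h ▸ hk)
    rw [wexp_bucketLaw_two_stage hb hne]
    have hρ : 0 ≤ ∏ k ∈ I, ρ k := prod_nonneg fun k hk =>
      (wexp_nonneg (bucketLaw_mem ⟨b k, hbV k (mem_insert_of_mem hk)⟩).1
        fun g => hf k (mem_insert_of_mem hk) _).trans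
        (hsingle k (mem_insert_of_mem hk) V (hbV k (mem_insert_of_mem hk)) (by omega) y hy)
    have hstep : ∀ g : Fin n → Fin C × ℤˣ,
        (wexp (bucketLaw (V.erase (b i))) fun g' => ∏ k ∈ insert i I,
          f k (bucketSum (b k) y fun j => if (g j).1 = b i then g j else g' j)) ≤
        (∏ k ∈ I, ρ k) * f i (bucketSum (b i) y g) := by
      intro g
      set z : Fin n → ℝ := fun j => if (g j).1 = b i then 0 else y j with hz
      have hzx : ∀ j, |z j| ≤ |x j| := by
        intro j
        simp only [hz]
        split_ifs
        · simp
        · exact hy j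
      have hih := ih (fun k hk => hf k (mem_insert_of_mem hk))
        (fun k hk => hsingle k (mem_insert_of_mem hk)) (V.erase (b i))
        (fun k hk => mem_erase.2 ⟨hbI k hk, hbV k (mem_insert_of_mem hk)⟩)
        (hinj.mono (by simp)) (by omega) z hzx
      have heq : (wexp (bucketLaw (V.erase (b i))) fun g' => ∏ k ∈ insert i I,
          f k (bucketSum (b k) y fun j => if (g j).1 = b i then g j else g' j)) =
          wexp (bucketLaw (V.erase (b i))) fun g' =>
            f i (bucketSum (b i) y g) * ∏ k ∈ I, f k (bucketSum (b k) z g') := by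
        refine wexp_congr fun g' hg' => ?_
        have hg'b : ∀ j, (g' j).1 ≠ b i := fun j h => hg' j (by simp [bucketLaw, h])
        rw [prod_insert hi]
        congr 1
        · congr 1
          refine sum_congr rfl fun j _ => ?_
          by_cases hj : (g j).1 = b i <;> simp [hj, hg'b]
        · refine prod_congr rfl fun k hk => congrArg _ (sum_congr rfl fun j _ => ?_)
          by_cases hj : (g j).1 = b i
          · simp [hj, hz, (hbI k hk).symm]
          · simp [hj, hz]
      rw [heq, wexp_const_mul, mul_comm]
      exact mul_le_mul_of_nonneg_right hih (hf i (mem_insert_self _ _) _)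
    refine (wexp_mono (bucketLaw_mem ⟨_, hb⟩).1 fun g _ => hstep g).trans ?_
    rw [wexp_const_mul, prod_insert hi, mul_comm]
    exact mul_le_mul_of_nonneg_right
      (hsingle i (mem_insert_self _ _) V hb (by omega) y hy) hρ

/-- The law of a uniform sign. -/
noncomputable def signLaw (_ : ℤˣ) : ℝ := 1 / 2

theorem signLaw_mem : signLaw ∈ stdSimplex ℝ ℤˣ :=
  ⟨fun _ => by norm_num [signLaw], by rw [sum_units]; norm_num [signLaw]⟩

/-- The law of one hash value `(h, s)`, uniform on `[C] × {±1}`. -/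
noncomputable abbrev letterLaw (C : ℕ) : Fin C × ℤˣ → ℝ := bucketLaw univ

theorem letterLaw_mem {C : ℕ} (hC : 0 < C) : letterLaw C ∈ stdSimplex ℝ (Fin C × ℤˣ) :=
  bucketLaw_mem ⟨⟨0, hC⟩, mem_univ _⟩

theorem letterLaw_apply {C : ℕ} (a : Fin C × ℤˣ) : letterLaw C a = 1 / (2 * C) := by
  simp [bucketLaw]

/-- Redrawing the signs of the coordinates in `p` does not change an expectation. -/
theorem wexp_resign {n C : ℕ} (p : Fin n → Prop) [DecidablePred p]
    (Φ : (Fin n → Fin C × ℤˣ) → ℝ) :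
    wexp (letterLaw C) Φ = wexp (letterLaw C) fun g => wexp signLaw fun ε =>
      Φ fun j => if p j then ((g j).1, ε j) else g j := by
  rw [← wexp_pair (letterLaw C) signLaw
    (fun g => Φ fun j => if p j then ((g j).1.1, (g j).2) else (g j).1)]
  refine (wexp_map (fun j (a : (Fin C × ℤˣ) × ℤˣ) => if p j then (a.1.1, a.2) else a.1)
    (fun j c => ?_) Φ).symm
  rw [sum_filter, Fintype.sum_prod_type]
  by_cases hj : p j
  · simp only [hj, if_true, letterLaw_apply, signLaw]
    rw [Fintype.sum_prod_type]
    obtain ⟨v, s⟩ := c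
    rw [Finset.sum_eq_single v (fun v' _ hv' => by simp [hv']) (by simp)]
    rcases Int.units_eq_one_or s with rfl | rfl <;> simp <;> ring
  · simp only [hj, if_false]
    rw [Finset.sum_eq_single c (fun a _ ha => by simp [ha]) (by simp)]
    simp [signLaw]
    ring

/-- If the two values of `Φ` under a flip of the `i`-th sign add up to at most `2 * c`, then the
expectation of `Φ` is at most `c`. -/
theorem wexp_signLaw_le {n : ℕ} (i : Fin n) (Φ : (Fin n → ℤˣ) → ℝ) (c : ℝ)
    (h : ∀ ε, Φ ε + Φ (fun j => if j = i then -ε j else ε j) ≤ 2 * c) :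
    wexp signLaw Φ ≤ c := by
  have h1 : wexp signLaw (fun ε => Φ fun j => if j = i then -ε j else ε j) = wexp signLaw Φ := by
    refine wexp_map (fun j (s : ℤˣ) => if j = i then -s else s) (fun j s => ?_) Φ
    rw [sum_filter]
    by_cases hj : j = i
    · rcases Int.units_eq_one_or s with rfl | rfl <;> simp [hj, signLaw]
    · simp only [hj, signLaw]
      simpa using (Int.units_eq_one_or s).resolve_left
  have h2 := wexp_mono signLaw_mem.1 fun ε _ => h ε
  rw [wexp_const signLaw_mem, wexp_add, h1] at h2
  linarith

/-- The error `s(i) y_{h(i)} - x_i` of the estimate of `x_i` by one row: the signed content of the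
bucket of `i` coming from the other coordinates. -/
def rowNoise {n C : ℕ} (x : Fin n → ℝ) (i : Fin n) (g : Fin n → Fin C × ℤˣ) : ℝ :=
  (((g i).2 : ℤ) : ℝ) * bucketSum (g i).1 (fun j => if j = i then 0 else x j) g

/-- The vote `±1` of a row on the question whether an error `z` exceeds `τ`. -/
noncomputable def vote (τ z : ℝ) : ℝ := if τ < z then 1 else -1

theorem exp_vote_add_le {τ l : ℝ} (hτ : 0 ≤ τ) (hl : 0 ≤ l) (z : ℝ) :
    Real.exp (l * vote τ z) + Real.exp (l * vote τ (-z)) ≤ 2 * Real.cosh l -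
      2 * (Real.cosh l - Real.exp (-l)) * (if |z| ≤ τ then 1 else 0) := by
  rw [Real.cosh_eq]
  have : Real.exp (-l) ≤ Real.exp l := Real.exp_le_exp.2 (by linarith)
  unfold vote
  by_cases h : |z| ≤ τ
  · have h1 := abs_le.1 h
    rw [if_neg (by linarith), if_neg (by linarith), if_pos h]
    simp only [mul_neg, mul_one]
    linarith
  · rw [if_neg h]
    by_cases h1 : τ < z
    · rw [if_pos h1, if_neg (by linarith)]
      simp only [mul_neg, mul_one]
      linarith
    · rw [if_neg h1]
      split_ifs <;> simp only [mul_neg, mul_one] <;> linarith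

theorem cosh_sub_le_exp {l : ℝ} (h0 : 0 ≤ l) (h1 : l ≤ 1 / 2) {P : ℝ} (hP : 4 * l ≤ P) :
    Real.cosh l - (Real.cosh l - Real.exp (-l)) * P ≤ Real.exp (-(l ^ 2)) := by
  have ha := abs_le.1 (Real.abs_exp_sub_one_sub_id_le (x := l) (by rw [abs_of_nonneg h0]; linarith))
  have hb := abs_le.1 (Real.abs_exp_sub_one_sub_id_le (x := -l) (by
    rw [abs_neg, abs_of_nonneg h0]; linarith))
  have hc : Real.cosh l ≤ 1 + l ^ 2 := by rw [Real.cosh_eq]; nlinarith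
  have hd := Real.one_le_cosh l
  have he : l / 2 ≤ Real.cosh l - Real.exp (-l) := by nlinarith
  have hf := Real.add_one_le_exp (-(l ^ 2))
  nlinarith

theorem cosh_le_one_add {y : ℝ} (hy : 0 ≤ y) : Real.cosh y ≤ 1 + y ^ 2 / 2 * Real.exp y := by
  have h1 : Real.exp y - 1 ≤ y * Real.exp y := by
    have := Real.add_one_le_exp (-y)
    have h2 : Real.exp (-y) * Real.exp y = 1 := by rw [← Real.exp_add]; simp
    nlinarith [Real.exp_pos y]
  have h3 : (Real.exp y - 1) ^ 2 ≤ (y * Real.exp y) ^ 2 :=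
    pow_le_pow_left₀ (by linarith [Real.one_le_exp hy]) h1 2
  have h2 : Real.exp (-y) * Real.exp y = 1 := by rw [← Real.exp_add]; simp
  have h4 : Real.exp (-y) * (Real.exp y - 1) ^ 2 ≤ Real.exp (-y) * (y * Real.exp y) ^ 2 :=
    mul_le_mul_of_nonneg_left h3 (Real.exp_pos _).le
  rw [Real.cosh_eq]
  have h5 : Real.exp (-y) * (Real.exp y - 1) ^ 2 = Real.exp y - 2 + Real.exp (-y) := by
    linear_combination (Real.exp y - 2) * h2
  have h6 : Real.exp (-y) * (y * Real.exp y) ^ 2 = y ^ 2 * Real.exp y := by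
    linear_combination (y ^ 2 * Real.exp y) * h2
  linarith

theorem wexp_collision {n C : ℕ} (hC : 0 < C) {i j : Fin n} (hij : i ≠ j) :
    wexp (letterLaw C) (fun g => if (g i).1 = (g j).1 then (1 : ℝ) else 0) = 1 / C := by
  have h1 : ∀ g : Fin n → Fin C × ℤˣ, (if (g i).1 = (g j).1 then (1 : ℝ) else 0) =
      ∑ v, (if (g i).1 = v then (1 : ℝ) else 0) * (if (g j).1 = v then (1 : ℝ) else 0) := by
    intro g
    simp [eq_comm]
  have h2 : ∀ v : Fin C, ∑ a, letterLaw C a * (if a.1 = v then (1 : ℝ) else 0) = 1 / C := by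
    intro v
    simp only [letterLaw_apply]
    rw [Fintype.sum_prod_type, Finset.sum_eq_single v (fun v' _ hv' => by simp [hv']) (by simp)]
    simp
    field_simp
  simp only [h1]
  rw [wexp_sum]
  have h3 : ∀ v : Fin C, wexp (letterLaw C) (fun g : Fin n → Fin C × ℤˣ =>
      (if (g i).1 = v then (1 : ℝ) else 0) * (if (g j).1 = v then (1 : ℝ) else 0)) =
        1 / C * (1 / C) := fun v => by
    rw [wexp_coord_mul (letterLaw_mem hC) hij (fun a => if a.1 = v then (1 : ℝ) else 0)
      (fun a => if a.1 = v then (1 : ℝ) else 0), h2]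
  rw [sum_congr rfl fun v _ => h3 v]
  have : (0 : ℝ) < C := by exact_mod_cast hC
  simp
  field_simp

open Classical in
theorem wexp_not_injOn_le {n C : ℕ} (hC : 0 < C) (I : Finset (Fin n)) :
    wexp (letterLaw C) (fun g =>
      if Set.InjOn (fun i => (g i).1) (I : Set (Fin n)) then (0 : ℝ) else 1) ≤ (#I : ℝ) ^ 2 / C := by
  have h1 : ∀ g : Fin n → Fin C × ℤˣ,
      (if Set.InjOn (fun i => (g i).1) (I : Set (Fin n)) then (0 : ℝ) else 1) ≤
        ∑ p ∈ I.offDiag, if (g p.1).1 = (g p.2).1 then (1 : ℝ) else 0 := by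
    intro g
    have hnn : ∀ p ∈ I.offDiag, (0 : ℝ) ≤ if (g p.1).1 = (g p.2).1 then (1 : ℝ) else 0 :=
      fun p _ => by split_ifs <;> norm_num
    split_ifs with h
    · exact sum_nonneg hnn
    · simp only [Set.InjOn] at h
      push Not at h
      obtain ⟨i, hi, j, hj, hij, hne⟩ := h
      have := single_le_sum hnn (mem_offDiag.2 (⟨hi, hj, hne⟩ : (i, j).1 ∈ I ∧ (i, j).2 ∈ I ∧ _))
      simpa [hij] using this
  refine (wexp_mono (letterLaw_mem hC).1 fun g _ => h1 g).trans ?_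
  rw [wexp_sum, sum_congr rfl fun p hp => wexp_collision hC (mem_offDiag.1 hp).2.2, sum_const,
    nsmul_eq_mul, mul_one_div]
  have : (#I.offDiag : ℝ) ≤ (#I : ℝ) ^ 2 := by
    rw [offDiag_card, sq]
    exact_mod_cast Nat.sub_le _ _
  gcongr

/-! ### The votes of one row -/

/-- One row without collisions inside `I`: given the buckets of `I`, the votes of the coordinates
of `I` have the same joint exponential moments as independent ones, up to domination. -/
theorem wexp_votes_of_injOn {n C : ℕ} (hC : 0 < C) (x : Fin n → ℝ) (I : Finset (Fin n))
    (l τ : Fin n → ℝ) (σ : Fin n → ℤˣ) (hl0 : ∀ i, 0 ≤ l i) (hl : ∀ i, l i ≤ 1 / 2)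
    (hτ : ∀ i, 0 ≤ τ i) (hIC : 2 * #I ≤ C)
    (hball : ∀ i ∈ I, ∀ V : Finset (Fin C), ∀ b ∈ V, C ≤ 2 * #V → ∀ y : Fin n → ℝ,
      (∀ j, |y j| ≤ |x j|) →
        4 * l i ≤ wexp (bucketLaw V) fun g => if |bucketSum b y g| ≤ τ i then (1 : ℝ) else 0)
    (b : Fin n → Fin C) (hb : Set.InjOn b I) :
    (wexp (letterLaw C) fun g' => wexp signLaw fun ε => Real.exp (∑ i ∈ I,
      l i * vote (τ i) (((σ i : ℤ) : ℝ) * rowNoise x i fun j =>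
        if j ∈ I then (b j, ε j) else g' j))) ≤ Real.exp (-∑ i ∈ I, l i ^ 2) := by
  set y : Fin n → ℝ := fun j => if j ∈ I then 0 else x j with hy
  set f : Fin n → ℝ → ℝ := fun i z =>
    ∑ s : ℤˣ, signLaw s * Real.exp (l i * vote (τ i) (((σ i : ℤ) : ℝ) * (((s : ℤ) : ℝ) * z))) with hf
  have hinner : ∀ g' : Fin n → Fin C × ℤˣ, (wexp signLaw fun ε => Real.exp (∑ i ∈ I,
      l i * vote (τ i) (((σ i : ℤ) : ℝ) * rowNoise x i fun j =>
        if j ∈ I then (b j, ε j) else g' j))) = ∏ i ∈ I, f i (bucketSum (b i) y g') := by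
    intro g'
    obtain ⟨F, hF⟩ : ∃ F : Fin n → ℤˣ → ℝ, F = fun i (s : ℤˣ) => if i ∈ I then Real.exp (l i *
        vote (τ i) (((σ i : ℤ) : ℝ) * (((s : ℤ) : ℝ) * bucketSum (b i) y g'))) else 1 := ⟨_, rfl⟩
    have h1 : ∀ ε : Fin n → ℤˣ, Real.exp (∑ i ∈ I,
        l i * vote (τ i) (((σ i : ℤ) : ℝ) * rowNoise x i fun j =>
          if j ∈ I then (b j, ε j) else g' j)) = ∏ i, F i (ε i) := by
      intro ε
      rw [hF, Real.exp_sum, prod_ite_mem, univ_inter]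
      refine prod_congr rfl fun i hi => ?_
      congr 4
      simp only [rowNoise, hi, if_true]
      congr 1
      refine sum_congr rfl fun j _ => ?_
      by_cases hj : j ∈ I
      · by_cases hji : j = i
        · simp [hji, hy, hi]
        · have : b j ≠ b i := fun h => hji (hb hj hi h)
          simp [hj, this, hy]
      · have : j ≠ i := fun h => hj (h ▸ hi)
        simp [hj, this, hy]
    rw [wexp_congr fun ε _ => h1 ε, wexp_prod, ← prod_subset (subset_univ I)]
    · exact prod_congr rfl fun i hi => by simp [hi, hf, hF]
    · intro i _ hi
      norm_num [hi, hF, signLaw]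
  simp only [hinner]
  have hyx : ∀ j, |y j| ≤ |x j| := fun j => by
    simp only [hy]
    split_ifs <;> simp
  have hprod := wexp_prod_buckets (M := C - #I) (by omega) x b f
    (fun i => Real.exp (-(l i ^ 2))) I
    (fun i _ z => sum_nonneg fun s _ => mul_nonneg (signLaw_mem.1 s) (Real.exp_pos _).le)
    (fun i hi V hbV hV y' hy' => by
      have hlaw := bucketLaw_mem ⟨b i, hbV⟩
      have hP := hball i hi V (b i) hbV (by omega) y' hy'
      refine le_trans ?_ (cosh_sub_le_exp (hl0 i) (hl i) hP)
      have h2 : ∀ g, f i (bucketSum (b i) y' g) ≤ Real.cosh (l i) +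
          (-(Real.cosh (l i) - Real.exp (-(l i)))) *
            if |bucketSum (b i) y' g| ≤ τ i then (1 : ℝ) else 0 := by
        intro g
        simp only [hf, sum_units, signLaw]
        have h3 := exp_vote_add_le (hτ i) (hl0 i) (bucketSum (b i) y' g)
        generalize (if |bucketSum (b i) y' g| ≤ τ i then (1 : ℝ) else 0) = t at h3 ⊢
        rcases Int.units_eq_one_or (σ i) with hs | hs <;> simp [hs] at h3 ⊢ <;> linarith
      refine (wexp_mono hlaw.1 fun g _ => h2 g).trans_eq ?_
      rw [wexp_add, wexp_const hlaw, wexp_const_mul]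
      ring)
    univ (fun _ _ => mem_univ _) hb (by simp; omega) y hyx
  refine hprod.trans_eq ?_
  rw [← Real.exp_sum, sum_neg_distrib]

/-- One row with arbitrary buckets: by convexity and symmetry, the exponential moment exceeds `1`
only to second order. -/
theorem wexp_votes_le {n C : ℕ} (x : Fin n → ℝ) (I : Finset (Fin n)) (hI : I.Nonempty)
    (l τ : Fin n → ℝ) (σ : Fin n → ℤˣ) {u : ℝ} (hl0 : ∀ i, 0 ≤ l i) (hl : ∀ i, l i ≤ u)
    (hτ : ∀ i, 0 ≤ τ i) (b : Fin n → Fin C) (g' : Fin n → Fin C × ℤˣ) :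
    (wexp signLaw fun ε => Real.exp (∑ i ∈ I,
      l i * vote (τ i) (((σ i : ℤ) : ℝ) * rowNoise x i fun j =>
        if j ∈ I then (b j, ε j) else g' j))) ≤
      1 + #I / 2 * Real.exp (#I * u) * ∑ i ∈ I, l i ^ 2 := by
  have hq : (0 : ℝ) < #I := by exact_mod_cast hI.card_pos
  set X : Fin n → (Fin n → ℤˣ) → ℝ := fun i ε => ((σ i : ℤ) : ℝ) * rowNoise x i fun j =>
        if j ∈ I then (b j, ε j) else g' j with hX
  have hjensen : ∀ ε : Fin n → ℤˣ, Real.exp (∑ i ∈ I, l i * vote (τ i) (X i ε)) ≤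
      ∑ i ∈ I, (1 / #I : ℝ) * Real.exp (#I * l i * vote (τ i) (X i ε)) := by
    intro ε
    have h := convexOn_exp.map_sum_le (t := I) (w := fun _ => (1 / #I : ℝ))
      (p := fun i => #I * l i * vote (τ i) (X i ε)) (fun _ _ => by positivity)
      (by simp [hq.ne']) (fun _ _ => Set.mem_univ _)
    simp only [smul_eq_mul] at h
    refine le_trans (le_of_eq ?_) h
    congr 1
    refine sum_congr rfl fun i _ => ?_
    field_simp
  have hflip : ∀ i ∈ I, wexp signLaw (fun ε => Real.exp (#I * l i * vote (τ i) (X i ε))) ≤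
      1 + #I ^ 2 / 2 * Real.exp (#I * u) * l i ^ 2 := by
    intro i hi
    have hpos : 0 ≤ #I * l i := mul_nonneg hq.le (hl0 i)
    refine (wexp_signLaw_le i _ (Real.cosh (#I * l i)) fun ε => ?_).trans ?_
    · have hneg : X i (fun j => if j = i then -ε j else ε j) = -X i ε := by
        simp only [hX, rowNoise, hi, if_true]
        have : (bucketSum (b i) (fun j => if j = i then 0 else x j) fun j =>
            if j ∈ I then (b j, if j = i then -ε j else ε j) else g' j) =
            bucketSum (b i) (fun j => if j = i then 0 else x j) fun j =>
              if j ∈ I then (b j, ε j) else g' j := by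
          refine sum_congr rfl fun j _ => ?_
          by_cases hj : j = i <;> simp [hj]
        rw [this]
        push_cast
        ring
      rw [hneg]
      refine (exp_vote_add_le (hτ i) hpos _).trans ?_
      have : Real.exp (-(#I * l i)) ≤ Real.cosh (#I * l i) := by
        have h1 := Real.one_le_cosh (#I * l i)
        have h2 := Real.exp_le_one_iff.2 (neg_nonpos.2 hpos)
        linarith
      have h3 : (0 : ℝ) ≤ if |X i ε| ≤ τ i then 1 else 0 := by split_ifs <;> norm_num
      nlinarith [mul_nonneg (sub_nonneg.2 this) h3]
    · refine (cosh_le_one_add hpos).trans ?_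
      have h1 : Real.exp (#I * l i) ≤ Real.exp (#I * u) :=
        Real.exp_le_exp.2 (mul_le_mul_of_nonneg_left (hl i) hq.le)
      have h2 : (#I * l i) ^ 2 / 2 * Real.exp (#I * l i) ≤
          (#I * l i) ^ 2 / 2 * Real.exp (#I * u) :=
        mul_le_mul_of_nonneg_left h1 (by positivity)
      linarith [show (#I * l i) ^ 2 / 2 * Real.exp (#I * u) =
        #I ^ 2 / 2 * Real.exp (#I * u) * l i ^ 2 by ring]
  refine (wexp_mono signLaw_mem.1 fun ε _ => hjensen ε).trans ?_
  rw [wexp_sum]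
  simp only [wexp_const_mul]
  rw [← mul_sum]
  refine (mul_le_mul_of_nonneg_left (sum_le_sum hflip) (by positivity)).trans_eq ?_
  rw [sum_add_distrib, ← mul_sum]
  simp
  field_simp

/-- The exponential moment of the votes of a small set `I` of coordinates in one row. A collision
inside `I` has probability at most `#I ^ 2 / C`, which is too small to matter. -/
theorem wexp_row_le {n C : ℕ} (hC : 0 < C) (x : Fin n → ℝ) (I : Finset (Fin n))
    (l τ : Fin n → ℝ) (σ : Fin n → ℤˣ) {u : ℝ} (hl0 : ∀ i, 0 ≤ l i) (hl : ∀ i, l i ≤ u)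
    (hu : u ≤ 1 / 2) (hτ : ∀ i, 0 ≤ τ i) (hIC : 2 * #I ≤ C)
    (hI : (#I : ℝ) ^ 2 * (#I + 2) * Real.exp (2 * #I * u) ≤ C)
    (hball : ∀ i ∈ I, ∀ V : Finset (Fin C), ∀ b ∈ V, C ≤ 2 * #V → ∀ y : Fin n → ℝ,
      (∀ j, |y j| ≤ |x j|) →
        4 * l i ≤ wexp (bucketLaw V) fun g => if |bucketSum b y g| ≤ τ i then (1 : ℝ) else 0) :
    (wexp (letterLaw C) fun g => Real.exp (∑ i ∈ I,
      l i * vote (τ i) (((σ i : ℤ) : ℝ) * rowNoise x i g))) ≤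
      Real.exp (-(∑ i ∈ I, l i ^ 2) / 2) := by
  classical
  have hlaw := letterLaw_mem hC
  have hCr : (0 : ℝ) < C := by exact_mod_cast hC
  set Λ := ∑ i ∈ I, l i ^ 2 with hΛ
  have hΛ0 : 0 ≤ Λ := sum_nonneg fun i _ => sq_nonneg _
  rw [wexp_resign (fun j => j ∈ I), wexp_resample hlaw (fun j => j ∈ I)]
  set B : ℝ := #I / 2 * Real.exp (#I * u) * Λ with hB
  have hB0 : 0 ≤ B := by positivity
  have he1 : Real.exp (-Λ) ≤ 1 := Real.exp_le_one_iff.2 (by linarith)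
  have hg : ∀ g : Fin n → Fin C × ℤˣ, (wexp (letterLaw C) fun g' => wexp signLaw fun ε =>
      Real.exp (∑ i ∈ I, l i * vote (τ i) (((σ i : ℤ) : ℝ) * rowNoise x i fun j =>
        if j ∈ I then ((if j ∈ I then g j else g' j).1, ε j) else
          if j ∈ I then g j else g' j))) ≤ Real.exp (-Λ) + (1 + B - Real.exp (-Λ)) *
            if Set.InjOn (fun i => (g i).1) (I : Set (Fin n)) then (0 : ℝ) else 1 := by
    intro g
    have hred : ∀ (g' : Fin n → Fin C × ℤˣ) (ε : Fin n → ℤˣ),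
        (fun j => if j ∈ I then ((if j ∈ I then g j else g' j).1, ε j) else
          if j ∈ I then g j else g' j) =
        fun j => if j ∈ I then ((g j).1, ε j) else g' j := by
      intro g' ε
      funext j
      by_cases hj : j ∈ I <;> simp [hj]
    simp only [hred]
    by_cases hinj : Set.InjOn (fun i => (g i).1) (I : Set (Fin n))
    · rw [if_pos hinj, mul_zero, add_zero]
      exact wexp_votes_of_injOn hC x I l τ σ hl0 (fun i => (hl i).trans hu) hτ hIC hball
        (fun i => (g i).1) hinj
    · rw [if_neg hinj]
      have hne : I.Nonempty := by
        rw [nonempty_iff_ne_empty]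
        rintro rfl
        simp at hinj
      refine wexp_le_const hlaw fun g' => ?_
      refine (wexp_votes_le x I hne l τ σ hl0 hl hτ (fun i => (g i).1) g').trans_eq ?_
      simp only [hB]
      ring
  refine (wexp_mono hlaw.1 fun g _ => hg g).trans ?_
  rw [wexp_add, wexp_const hlaw, wexp_const_mul]
  -- the collision term is absorbed by the gap between `exp (-Λ)` and `exp (-Λ / 2)`
  have hcol := mul_le_mul_of_nonneg_left (wexp_not_injOn_le (n := n) hC I)
    (show 0 ≤ 1 + B - Real.exp (-Λ) by linarith)
  refine (add_le_add_right hcol _).trans ?_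
  set q : ℝ := (#I : ℝ) with hq
  have hq0 : 0 ≤ q := Nat.cast_nonneg _
  rcases I.eq_empty_or_nonempty with hIe | hIne
  · have : q = 0 := by simp [hq, hIe]
    have hΛe : Λ = 0 := by simp [hΛ, hIe]
    simp [this, hΛe]
  have hu0 : 0 ≤ u := by
    obtain ⟨i, -⟩ := hIne
    exact (hl0 i).trans (hl i)
  have hΛu : Λ ≤ q * u := by
    have : ∀ i ∈ I, l i ^ 2 ≤ u := fun i _ => by nlinarith [hl0 i, hl i]
    calc Λ ≤ ∑ i ∈ I, u := sum_le_sum this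
      _ = q * u := by simp [hq]
  set E := Real.exp (q * u) with hE
  have hE1 : 1 ≤ E := Real.one_le_exp (by positivity)
  have hEE : Real.exp (2 * q * u) = E * E := by
    rw [hE, ← Real.exp_add]; congr 1; ring
  rw [hEE] at hI
  have h1 : 1 - Real.exp (-Λ) ≤ Λ := by linarith [Real.add_one_le_exp (-Λ)]
  have hinvE : 1 / E ≤ Real.exp (-Λ) := by
    rw [hE, one_div, ← Real.exp_neg]
    exact Real.exp_le_exp.2 (by linarith)
  have h2 : Real.exp (-Λ) * (1 + Λ / 2) ≤ Real.exp (-Λ / 2) := by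
    have h3 : Real.exp (-Λ / 2) = Real.exp (-Λ) * Real.exp (Λ / 2) := by
      rw [← Real.exp_add]; congr 1; ring
    rw [h3]
    exact mul_le_mul_of_nonneg_left (by linarith [Real.add_one_le_exp (Λ / 2)]) (Real.exp_pos _).le
  have h4 : (1 + B - Real.exp (-Λ)) * (q ^ 2 / C) ≤ 1 / E * (Λ / 2) := by
    have h5 : 1 + B - Real.exp (-Λ) ≤ (q + 2) * E * (Λ / 2) := by
      rw [hB]
      nlinarith
    calc (1 + B - Real.exp (-Λ)) * (q ^ 2 / C) ≤ (q + 2) * E * (Λ / 2) * (q ^ 2 / C) :=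
          mul_le_mul_of_nonneg_right h5 (by positivity)
      _ = (q ^ 2 * (q + 2) * (E * E)) / C * (1 / E * (Λ / 2)) := by field_simp
      _ ≤ 1 * (1 / E * (Λ / 2)) := by
          refine mul_le_mul_of_nonneg_right ?_ (by positivity)
          rw [div_le_one hCr]
          exact hI
      _ = _ := one_mul _
  have h6 : 1 / E * (Λ / 2) ≤ Real.exp (-Λ) * (Λ / 2) :=
    mul_le_mul_of_nonneg_right hinvE (by positivity)
  linarith

/-! ### Medians over the rows -/

theorem card_le_of_lt_median {R : ℕ} (a : Fin R → ℝ) {y : ℝ} (h : y < median a) :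
    R ≤ 2 * #{u | y < a u} := by
  rcases Nat.eq_zero_or_pos R with rfl | hR
  · simp
  have hmono := Tuple.monotone_sort a
  rw [median, dif_pos hR] at h
  set hi : Fin R := ⟨R / 2, by omega⟩ with hhi
  have h1 : a (Tuple.sort a ⟨(R - 1) / 2, by omega⟩) ≤ a (Tuple.sort a hi) :=
    hmono (Fin.mk_le_mk.2 (by omega))
  have h2 : y < a (Tuple.sort a hi) := by linarith
  have h3 : #(Ici hi) ≤ #{u | y < a u} := by
    refine card_le_card_of_injOn (Tuple.sort a) (fun u hu => ?_) (Tuple.sort a).injective.injOn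
    simp only [coe_filter, mem_univ, true_and, Set.mem_ofPred_eq]
    exact h2.trans_le (hmono (mem_Ici.1 hu))
  rw [Fin.card_Ici] at h3
  simp only [hhi] at h3
  omega

theorem card_le_of_median_lt {R : ℕ} (a : Fin R → ℝ) {y : ℝ} (h : median a < y) :
    R ≤ 2 * #{u | a u < y} := by
  rcases Nat.eq_zero_or_pos R with rfl | hR
  · simp
  have hmono := Tuple.monotone_sort a
  rw [median, dif_pos hR] at h
  set lo : Fin R := ⟨(R - 1) / 2, by omega⟩ with hlo
  have h1 : a (Tuple.sort a lo) ≤ a (Tuple.sort a ⟨R / 2, by omega⟩) :=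
    hmono (Fin.mk_le_mk.2 (by omega))
  have h2 : a (Tuple.sort a lo) < y := by linarith
  have h3 : #(Iic lo) ≤ #{u | a u < y} := by
    refine card_le_card_of_injOn (Tuple.sort a) (fun u hu => ?_) (Tuple.sort a).injective.injOn
    simp only [coe_filter, mem_univ, true_and, Set.mem_ofPred_eq]
    exact (hmono (mem_Iic.1 hu)).trans_lt h2
  rw [Fin.card_Iic] at h3
  simp only [hlo] at h3
  omega

/-- The error of the estimate of `x i` when row `u` has the hash values `G u`. -/
noncomputable def medianError {R n C : ℕ} (x : Fin n → ℝ) (i : Fin n) (G : Fin R → Fin n → Fin C × ℤˣ) : ℝ :=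
  median (fun u => x i + rowNoise x i (G u)) - x i

theorem sum_vote_nonneg {R n C : ℕ} (x : Fin n → ℝ) (i : Fin n)
    (G : Fin R → Fin n → Fin C × ℤˣ) (σ : ℤˣ) {τ : ℝ}
    (h : τ < ((σ : ℤ) : ℝ) * medianError x i G) :
    0 ≤ ∑ u, vote τ (((σ : ℤ) : ℝ) * rowNoise x i (G u)) := by
  have hcard : R ≤ 2 * #{u | τ < ((σ : ℤ) : ℝ) * rowNoise x i (G u)} := by
    unfold medianError at h
    rcases Int.units_eq_one_or σ with rfl | rfl
    · simp only [Units.val_one, Int.cast_one, one_mul] at h ⊢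
      refine (card_le_of_lt_median _ (y := x i + τ) (by linarith)).trans_eq ?_
      congr 2
      ext u
      simp
    · simp only [Units.val_neg, Units.val_one, Int.cast_neg, Int.cast_one, neg_mul, one_mul] at h ⊢
      refine (card_le_of_median_lt _ (y := x i - τ) (by linarith)).trans_eq ?_
      congr 2
      ext u
      simp only [mem_filter, mem_univ, true_and]
      constructor <;> intro <;> linarith
  have h1 : ∀ z, vote τ z = 2 * (if τ < z then 1 else 0) - 1 := by
    intro z; unfold vote; split_ifs <;> norm_num
  simp only [h1]
  rw [sum_sub_distrib, ← mul_sum, sum_boole]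
  have : (R : ℝ) ≤ 2 * #{u | τ < ((σ : ℤ) : ℝ) * rowNoise x i (G u)} := by exact_mod_cast hcard
  simp
  linarith

theorem card_le_of_lt_abs_medianError {R n C : ℕ} (x : Fin n → ℝ) (i : Fin n)
    (G : Fin R → Fin n → Fin C × ℤˣ) {τ : ℝ} (h : τ < |medianError x i G|) :
    R ≤ 2 * #{u | τ < |rowNoise x i (G u)|} := by
  unfold medianError at h
  rcases lt_abs.1 h with h | h
  · refine (card_le_of_lt_median _ (y := x i + τ) (by linarith)).trans ?_
    refine Nat.mul_le_mul_left 2 (card_le_card (monotone_filter_right _ fun u _ hu => ?_))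
    exact lt_abs.2 (Or.inl (by linarith))
  · refine (card_le_of_median_lt _ (y := x i - τ) (by linarith)).trans ?_
    refine Nat.mul_le_mul_left 2 (card_le_card (monotone_filter_right _ fun u _ hu => ?_))
    exact lt_abs.2 (Or.inr (by linarith))

/-- The law of all hash values of one row. -/
noncomputable def rowLaw (n C : ℕ) (g : Fin n → Fin C × ℤˣ) : ℝ := ∏ j, letterLaw C (g j)

theorem rowLaw_mem {n C : ℕ} (hC : 0 < C) : rowLaw n C ∈ stdSimplex ℝ (Fin n → Fin C × ℤˣ) :=
  pi_mem_stdSimplex (letterLaw_mem hC)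

open Classical in
/-- The joint large-deviation bound (Chernoff's method) for the coordinates of a small set `I`. The
coordinates with `l i = 0` are free. -/
theorem wexp_joint_le {R n C : ℕ} (hC : 0 < C) (x : Fin n → ℝ) (I : Finset (Fin n))
    (l τ : Fin n → ℝ) (σ : Fin n → ℤˣ) {u : ℝ} (hl0 : ∀ i, 0 ≤ l i) (hl : ∀ i, l i ≤ u)
    (hu : u ≤ 1 / 2) (hτ : ∀ i, 0 ≤ τ i) (hIC : 2 * #I ≤ C)
    (hI : (#I : ℝ) ^ 2 * (#I + 2) * Real.exp (2 * #I * u) ≤ C)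
    (hball : ∀ i ∈ I, ∀ V : Finset (Fin C), ∀ b ∈ V, C ≤ 2 * #V → ∀ y : Fin n → ℝ,
      (∀ j, |y j| ≤ |x j|) →
        4 * l i ≤ wexp (bucketLaw V) fun g => if |bucketSum b y g| ≤ τ i then (1 : ℝ) else 0) :
    (wexp (rowLaw n C) fun G : Fin R → Fin n → Fin C × ℤˣ =>
      if ∀ i ∈ I, l i = 0 ∨ τ i < ((σ i : ℤ) : ℝ) * medianError x i G then (1 : ℝ) else 0) ≤
      Real.exp (-(R * ∑ i ∈ I, l i ^ 2) / 2) := by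
  set F : Fin R → (Fin n → Fin C × ℤˣ) → ℝ := fun _ g => Real.exp (∑ i ∈ I,
      l i * vote (τ i) (((σ i : ℤ) : ℝ) * rowNoise x i g)) with hF
  have hle : ∀ G : Fin R → Fin n → Fin C × ℤˣ,
      (if ∀ i ∈ I, l i = 0 ∨ τ i < ((σ i : ℤ) : ℝ) * medianError x i G then (1 : ℝ) else 0) ≤
        ∏ u, F u (G u) := by
    intro G
    split_ifs with h
    · simp only [hF]
      rw [← Real.exp_sum, sum_comm]
      refine Real.one_le_exp (sum_nonneg fun i hi => ?_)
      rw [← mul_sum]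
      rcases h i hi with h0 | h0
      · simp [h0]
      · exact mul_nonneg (hl0 i) (sum_vote_nonneg x i G (σ i) h0)
    · exact prod_nonneg fun _ _ => (Real.exp_pos _).le
  refine (wexp_mono (rowLaw_mem hC).1 fun G _ => hle G).trans ?_
  rw [wexp_prod]
  have hrow : ∀ u : Fin R, ∑ g, rowLaw n C g * F u g ≤ Real.exp (-(∑ i ∈ I, l i ^ 2) / 2) :=
    fun _ => wexp_row_le hC x I l τ σ hl0 hl hu hτ hIC hI hball
  refine (prod_le_prod (fun u _ => sum_nonneg fun g _ => mul_nonneg ((rowLaw_mem hC).1 g)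
    (Real.exp_pos _).le) fun u _ => hrow u).trans_eq ?_
  rw [prod_const, card_univ, Fintype.card_fin, ← Real.exp_nat_mul]
  congr 1
  ring

/-- The error of one row is large only if a coordinate of `H` falls into the same bucket or the
rest of the bucket violates Chebyshev's inequality. -/
theorem wexp_rowNoise_le {n C : ℕ} (hC : 0 < C) (x : Fin n → ℝ) (i : Fin n) (H : Finset (Fin n))
    {τ v : ℝ} (hτ : 0 ≤ τ) (hv : 0 ≤ v) (hT : ∑ j with j ∉ H, x j ^ 2 ≤ v * C * τ ^ 2) :
    (wexp (letterLaw C) fun g => if τ < |rowNoise x i g| then (1 : ℝ) else 0) ≤ #H / C + v := by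
  have hlaw := letterLaw_mem hC
  have hCr : (0 : ℝ) < C := by exact_mod_cast hC
  rw [wexp_resample hlaw (fun j => j = i)]
  refine wexp_le_const hlaw fun g => ?_
  set b := (g i).1 with hb
  set z : Fin n → ℝ := fun j => if j ∈ H ∨ j = i then 0 else x j with hz
  set X : Fin C × ℤˣ → ℝ := fun a => if a.1 = b then ((a.2 : ℤ) : ℝ) else 0 with hX
  have hX0 : ∑ a, letterLaw C a * X a = 0 := by
    simp only [letterLaw_apply]
    rw [Fintype.sum_prod_type]
    refine sum_eq_zero fun v _ => ?_
    rw [sum_units]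
    by_cases hvb : v = b <;> simp [hX, hvb]
  have hX2 : ∑ a, letterLaw C a * X a ^ 2 = 1 / C := by
    simp only [letterLaw_apply]
    rw [Fintype.sum_prod_type, Finset.sum_eq_single b (fun v _ hvb => by simp [hX, hvb]) (by simp),
      sum_units]
    simp [hX]
    field_simp
    norm_num
  have hzT : ∑ j, z j ^ 2 ≤ v * C * τ ^ 2 := by
    refine le_trans ?_ hT
    rw [sum_filter]
    refine sum_le_sum fun j _ => ?_
    by_cases hj : j ∈ H
    · simp [hz, hj]
    · by_cases hji : j = i
      · simp [hz, hji]
        split_ifs <;> positivity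
      · simp [hz, hj, hji]
  have hcheb : (wexp (letterLaw C) fun g' : Fin n → Fin C × ℤˣ =>
      if τ < |∑ j, z j * X (g' j)| then (1 : ℝ) else 0) ≤ v := by
    rcases hτ.eq_or_lt with h0 | hpos
    · subst h0
      have hz0 : ∀ j, z j = 0 := by
        intro j
        have hs : ∑ j, z j ^ 2 = 0 :=
          le_antisymm (by simpa using hzT) (sum_nonneg fun _ _ => sq_nonneg _)
        have := (sum_eq_zero_iff_of_nonneg fun _ _ => sq_nonneg _).1 hs j (mem_univ j)
        exact pow_eq_zero_iff (two_ne_zero) |>.1 this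
      refine wexp_le_const hlaw fun g' => ?_
      simp [hz0, hv]
    · have hle : ∀ g' : Fin n → Fin C × ℤˣ,
          (if τ < |∑ j, z j * X (g' j)| then (1 : ℝ) else 0) ≤
            (1 / τ ^ 2) * (∑ j, z j * X (g' j)) ^ 2 := by
        intro g'
        split_ifs with h
        · rw [one_div_mul_eq_div, one_le_div (by positivity), ← sq_abs (∑ j, z j * X (g' j))]
          exact pow_le_pow_left₀ hτ h.le 2
        · positivity
      refine (wexp_mono hlaw.1 fun g' _ => hle g').trans ?_
      rw [wexp_const_mul, wexp_sq_sum hlaw X hX0, hX2, mul_one_div, one_div_mul_eq_div,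
        div_div, div_le_iff₀ (by positivity)]
      linarith
  have hhit : (wexp (letterLaw C) fun g' : Fin n → Fin C × ℤˣ =>
      ∑ j ∈ H, if (g' j).1 = b then (1 : ℝ) else 0) = #H / C := by
    rw [wexp_sum]
    have : ∀ j ∈ H, (wexp (letterLaw C) fun g' : Fin n → Fin C × ℤˣ =>
        if (g' j).1 = b then (1 : ℝ) else 0) = 1 / C := by
      intro j _
      rw [wexp_coord hlaw j (fun a => if a.1 = b then (1 : ℝ) else 0), ← hX2]
      refine sum_congr rfl fun a _ => ?_
      rcases Int.units_eq_one_or a.2 with hs | hs <;> by_cases hab : a.1 = b <;>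
        simp [hX, hs, hab]
    rw [sum_congr rfl this, sum_const, nsmul_eq_mul, mul_one_div]
  have key : ∀ g' : Fin n → Fin C × ℤˣ,
      (if τ < |rowNoise x i fun j => if j = i then g j else g' j| then (1 : ℝ) else 0) ≤
        (∑ j ∈ H, if (g' j).1 = b then (1 : ℝ) else 0) +
          if τ < |∑ j, z j * X (g' j)| then (1 : ℝ) else 0 := by
    intro g'
    have hnn : ∀ j ∈ H, (0 : ℝ) ≤ if (g' j).1 = b then (1 : ℝ) else 0 :=
      fun j _ => by split_ifs <;> norm_num
    by_cases hex : ∃ j ∈ H, (g' j).1 = b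
    · obtain ⟨j, hj, hjb⟩ := hex
      have h1 := single_le_sum hnn hj
      simp only [hjb, if_true] at h1
      split_ifs <;> linarith
    · push Not at hex
      have heq : |rowNoise x i fun j => if j = i then g j else g' j| = |∑ j, z j * X (g' j)| := by
        have hs : |(((g i).2 : ℤ) : ℝ)| = 1 := by
          rcases Int.units_eq_one_or (g i).2 with hs | hs <;> simp [hs]
        simp only [rowNoise, if_true]
        rw [abs_mul, hs, one_mul]
        congr 1
        refine sum_congr rfl fun j _ => ?_
        by_cases hji : j = i
        · simp [hji, hz]
        · by_cases hj : j ∈ H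
          · simp [hji, hj, hz, hex j hj, ← hb]
          · simp [hji, hj, hz, hX, ← hb, mul_comm]
      rw [heq]
      linarith [sum_nonneg hnn]
  refine (wexp_mono hlaw.1 fun g' _ => key g').trans ?_
  rw [wexp_add, hhit]
  linarith

/-- A median over `R` rows is large with probability at most `(2 * β) ^ R` if the error of one row
is large with probability at most `β ^ 2`. -/
theorem wexp_medianError_le {R n C : ℕ} (hC : 0 < C) (x : Fin n → ℝ) (i : Fin n) {τ β : ℝ}
    (hβ0 : 0 < β) (hβ1 : β ≤ 1)
    (h : (wexp (letterLaw C) fun g => if τ < |rowNoise x i g| then (1 : ℝ) else 0) ≤ β ^ 2) :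
    (wexp (rowLaw n C) fun G : Fin R → Fin n → Fin C × ℤˣ =>
      if τ < |medianError x i G| then (1 : ℝ) else 0) ≤ (2 * β) ^ R := by
  have hlaw := letterLaw_mem hC
  -- `∏ u, F u (G u) = β ^ (R - 2 * m)`, where `m` is the number of rows with a large error
  set F : Fin R → (Fin n → Fin C × ℤˣ) → ℝ := fun _ g =>
    β * ((β⁻¹) ^ 2) ^ (if τ < |rowNoise x i g| then 1 else 0) with hF
  have hle : ∀ G : Fin R → Fin n → Fin C × ℤˣ,
      (if τ < |medianError x i G| then (1 : ℝ) else 0) ≤ ∏ u, F u (G u) := by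
    intro G
    split_ifs with hG
    · have hcard := card_le_of_lt_abs_medianError x i G hG
      simp only [hF]
      rw [prod_mul_distrib, prod_const, card_univ, Fintype.card_fin, prod_pow_eq_pow_sum,
        ← card_filter, ← pow_mul]
      calc (1 : ℝ) = β ^ R * β⁻¹ ^ R := by rw [← mul_pow, mul_inv_cancel₀ hβ0.ne', one_pow]
        _ ≤ _ := by
          refine mul_le_mul_of_nonneg_left ?_ (by positivity)
          exact pow_le_pow_right₀ ((one_le_inv₀ hβ0).2 hβ1) hcard
    · exact prod_nonneg fun _ _ => by simp only [hF]; positivity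
  refine (wexp_mono (rowLaw_mem hC).1 fun G _ => hle G).trans ?_
  rw [wexp_prod]
  have hrow : ∀ u : Fin R, ∑ g, rowLaw n C g * F u g ≤ 2 * β := by
    intro u
    change wexp (letterLaw C) (F u) ≤ 2 * β
    have h1 : ∀ g : Fin n → Fin C × ℤˣ,
        F u g ≤ β + β⁻¹ * if τ < |rowNoise x i g| then (1 : ℝ) else 0 := by
      intro g
      simp only [hF]
      split_ifs
      · have : β * (β⁻¹ ^ 2) ^ 1 = β⁻¹ := by field_simp
        rw [this]
        linarith
      · simp
    refine (wexp_mono hlaw.1 fun g _ => h1 g).trans ?_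
    rw [wexp_add, wexp_const hlaw, wexp_const_mul]
    have : β⁻¹ * (wexp (letterLaw C) fun g => if τ < |rowNoise x i g| then (1 : ℝ) else 0) ≤
        β⁻¹ * β ^ 2 := mul_le_mul_of_nonneg_left h (by positivity)
    have h2 : β⁻¹ * β ^ 2 = β := by field_simp
    linarith
  refine (prod_le_prod (fun u _ => sum_nonneg fun g _ => mul_nonneg ((rowLaw_mem hC).1 g)
    (by simp only [hF]; positivity)) fun u _ => hrow u).trans_eq ?_
  simp

/-! ### Concentration of a sum from joint tail bounds for small subfamilies -/

/-- The exponential of a multiple of an average is at most the average, over all subsets of size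
`q`, of the exponentials of the partial sums. -/
theorem exp_average_le {κ : Type*} [DecidableEq κ] (S : Finset κ) (z : κ → ℝ) {q : ℕ} (hq : 1 ≤ q)
    (hqS : q ≤ #S) :
    Real.exp (q / #S * ∑ i ∈ S, z i) ≤
      ∑ I ∈ S.powersetCard q, 1 / ((#S).choose q : ℝ) * Real.exp (∑ i ∈ I, z i) := by
  have hch : (0 : ℝ) < (#S).choose q := by exact_mod_cast Nat.choose_pos hqS
  have hS : (0 : ℝ) < #S := by exact_mod_cast (by omega : 0 < #S)
  have h := convexOn_exp.map_sum_le (t := S.powersetCard q)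
    (w := fun _ => 1 / ((#S).choose q : ℝ)) (p := fun I => ∑ i ∈ I, z i)
    (fun _ _ => by positivity) (by simp [hch.ne']) (fun _ _ => Set.mem_univ _)
  simp only [smul_eq_mul] at h
  refine le_trans (le_of_eq ?_) h
  congr 1
  have h1 : ∑ I ∈ S.powersetCard q, ∑ i ∈ I, z i =
      ∑ i ∈ S, ((#S - 1).choose (q - 1) : ℝ) * z i := by
    rw [sum_comm' (t' := S) (s' := fun i => (S.powersetCard q).filter ({i} ⊆ ·))]
    · refine sum_congr rfl fun i hi => ?_
      rw [sum_const, nsmul_eq_mul, card_filter_powersetCard_subset]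
      · simp
      · simpa using hi
      · simpa using hq
    · intro I i
      simp only [mem_filter, mem_powersetCard, singleton_subset_iff]
      constructor
      · rintro ⟨⟨h1, h2⟩, h3⟩
        exact ⟨⟨⟨h1, h2⟩, h3⟩, h1 h3⟩
      · rintro ⟨h1, -⟩
        exact h1
  have h2 : (#S : ℝ) * (#S - 1).choose (q - 1) = (#S).choose q * q := by
    have := Nat.add_one_mul_choose_eq (#S - 1) (q - 1)
    rw [Nat.sub_add_cancel (by omega), Nat.sub_add_cancel hq] at this
    exact_mod_cast this
  rw [← mul_sum, h1, ← mul_sum, ← mul_assoc]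
  congr 1
  field_simp
  linarith

open Classical in
/-- The largest `m ≤ L` with `m * θ < e ^ 2`, and `0` if there is none. -/
noncomputable def level (θ : ℝ) (L : ℕ) (e : ℝ) : ℕ :=
  Nat.findGreatest (fun m => m * θ < e ^ 2) L

theorem level_le (θ : ℝ) (L : ℕ) (e : ℝ) : level θ L e ≤ L := Nat.findGreatest_le L

theorem level_spec (θ : ℝ) (L : ℕ) (e : ℝ) : level θ L e = 0 ∨ level θ L e * θ < e ^ 2 := by
  classical
  by_cases h : level θ L e = 0
  · exact Or.inl h
  · exact Or.inr (Nat.findGreatest_of_ne_zero (P := fun m : ℕ => m * θ < e ^ 2) (n := L)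
      (m := level θ L e) rfl h)

theorem sq_le_of_level (θ : ℝ) (L : ℕ) (e : ℝ) (h : e ^ 2 ≤ (L + 1) * θ) :
    e ^ 2 ≤ (level θ L e + 1) * θ := by
  classical
  rcases (level_le θ L e).lt_or_eq with h1 | h1
  · have := Nat.findGreatest_is_greatest (P := fun m : ℕ => m * θ < e ^ 2) (n := L)
      (k := level θ L e + 1) (Nat.lt_succ_self _) h1
    push_cast at this
    exact not_lt.1 this
  · rw [h1]; exact h

theorem sum_exp_neg_le (L : ℕ) :
    ∑ p ∈ range (L + 1) ×ˢ (univ : Finset ℤˣ), Real.exp (-(p.1 : ℝ)) ≤ 4 := by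
  rw [sum_product]
  simp only [sum_units]
  have h1 : ∀ m : ℕ, Real.exp (-(m : ℝ)) ≤ (1 / 2) ^ m := by
    intro m
    have : Real.exp (-(m : ℝ)) = Real.exp (-1) ^ m := by
      rw [← Real.exp_nat_mul]; congr 1; ring
    rw [this]
    refine pow_le_pow_left₀ (Real.exp_pos _).le ?_ m
    rw [Real.exp_neg, one_div]
    exact inv_anti₀ (by norm_num) (by linarith [Real.add_one_le_exp (1 : ℝ)])
  have h2 := (sum_le_sum fun m (_ : m ∈ range (L + 1)) => h1 m).trans (sum_geometric_two_le (L + 1))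
  rw [sum_add_distrib]
  linarith

section

variable {ι α κ : Type*} [Fintype ι] [DecidableEq ι] [Fintype α] [Fintype κ] [DecidableEq κ]
  {w : α → ℝ}

open Classical in
/-- Joint exponential tails for the family `e i`, `i ∈ I`, at all levels up to `L` give an
exponential moment of the sum of the levels. -/
theorem wexp_exp_level_le (hw : w ∈ stdSimplex ℝ α) (e : (ι → α) → κ → ℝ) (I : Finset κ)
    {θ : ℝ} {L : ℕ} (τ : ℕ → ℝ) (hτ : ∀ m, 0 ≤ τ m) (hτθ : ∀ m, τ m ^ 2 = m * θ)
    (hjoint : ∀ (t : κ → ℕ) (σ : κ → ℤˣ), (∀ i, t i ≤ L) →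
      wexp w (fun G => if ∀ i ∈ I, t i = 0 ∨ τ (t i) < ((σ i : ℤ) : ℝ) * e G i
        then (1 : ℝ) else 0) ≤ Real.exp (-(2 * ∑ i ∈ I, (t i : ℝ)))) :
    wexp w (fun G => Real.exp (∑ i ∈ I, (level θ L (e G i) : ℝ))) ≤ 4 ^ #I := by
  -- `exp (level)` is at most the sum over all levels `m` and signs `s` of `exp m` times the
  -- indicator of `m = 0 ∨ τ m < s * e`; expand the product over `I` of these sums
  set P : κ → Finset (ℕ × ℤˣ) := fun i => if i ∈ I then range (L + 1) ×ˢ univ else {(0, 1)} with hP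
  set f : (ι → α) → κ → ℕ × ℤˣ → ℝ := fun G i p =>
    Real.exp p.1 * if p.1 = 0 ∨ τ p.1 < ((p.2 : ℤ) : ℝ) * e G i then 1 else 0 with hf
  have hf0 : ∀ G i p, 0 ≤ f G i p := fun G i p => by
    simp only [hf]; split_ifs <;> simp [(Real.exp_pos _).le]
  have hfactor : ∀ G, ∀ i ∈ I, Real.exp (level θ L (e G i)) ≤ ∑ p ∈ P i, f G i p := by
    intro G i hi
    set m := level θ L (e G i) with hm
    have hmL : m ∈ range (L + 1) := mem_range.2 (Nat.lt_succ_of_le (level_le _ _ _))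
    obtain ⟨s, hs⟩ : ∃ s : ℤˣ, m = 0 ∨ τ m < ((s : ℤ) : ℝ) * e G i := by
      rcases level_spec θ L (e G i) with h | h
      · exact ⟨1, Or.inl h⟩
      · rw [← hm, ← hτθ] at h
        rcases lt_abs.1 (abs_of_nonneg (hτ m) ▸ sq_lt_sq.1 h) with h' | h'
        · exact ⟨1, Or.inr (by simpa using h')⟩
        · exact ⟨-1, Or.inr (by simpa using h')⟩
    have h1 : f G i (m, s) = Real.exp m := by simp only [hf]; rw [if_pos hs, mul_one]
    rw [← h1]
    refine single_le_sum (fun p _ => hf0 G i p) ?_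
    simp only [hP, hi, if_true]
    exact mem_product.2 ⟨hmL, mem_univ _⟩
  have hexp : ∀ G, Real.exp (∑ i ∈ I, (level θ L (e G i) : ℝ)) ≤
      ∑ p ∈ Fintype.piFinset P, ∏ i, f G i (p i) := by
    intro G
    rw [← prod_univ_sum, Real.exp_sum, ← prod_subset (subset_univ I)]
    · exact prod_le_prod (fun _ _ => (Real.exp_pos _).le) (hfactor G)
    · intro i _ hi
      simp [hP, hi, hf]
  refine (wexp_mono hw.1 fun G _ => hexp G).trans ?_
  rw [wexp_sum]
  have hterm : ∀ p ∈ Fintype.piFinset P, wexp w (fun G => ∏ i, f G i (p i)) ≤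
      ∏ i, Real.exp (-((p i).1 : ℝ)) := by
    intro p hp
    rw [Fintype.mem_piFinset] at hp
    have hp0 : ∀ i, i ∉ I → (p i).1 = 0 := by
      intro i hi
      have := hp i
      simp only [hP, hi, if_false, mem_singleton] at this
      simp [this]
    have hpL : ∀ i, (p i).1 ≤ L := by
      intro i
      by_cases hi : i ∈ I
      · have := hp i
        simp only [hP, hi, if_true, mem_product, mem_range] at this
        omega
      · simp [hp0 i hi]
    have h1 : ∀ G, ∏ i, f G i (p i) = Real.exp (∑ i ∈ I, ((p i).1 : ℝ)) *
        if ∀ i ∈ I, (p i).1 = 0 ∨ τ (p i).1 < (((p i).2 : ℤ) : ℝ) * e G i then (1 : ℝ) else 0 := by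
      intro G
      rw [Real.exp_sum, ← prod_subset (subset_univ I)]
      · simp only [hf]
        rw [prod_mul_distrib, prod_ite_zero]
        simp
      · intro i _ hi
        simp [hf, hp0 i hi]
    simp only [h1]
    rw [wexp_const_mul]
    refine (mul_le_mul_of_nonneg_left (hjoint (fun i => (p i).1) (fun i => (p i).2) hpL)
      (Real.exp_pos _).le).trans_eq ?_
    rw [← Real.exp_add, ← Real.exp_sum, ← sum_subset (subset_univ I)]
    · congr 1
      rw [sum_neg_distrib]
      ring
    · intro i _ hi
      simp [hp0 i hi]
  refine (sum_le_sum hterm).trans ?_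
  rw [← prod_univ_sum P (fun _ p => Real.exp (-(p.1 : ℝ))), ← prod_subset (subset_univ I)]
  · refine (prod_le_prod (fun i _ => sum_nonneg fun _ _ => (Real.exp_pos _).le)
      fun i hi => ?_).trans_eq (prod_const 4)
    simp only [hP, hi, if_true]
    exact sum_exp_neg_le L
  · intro i _ hi
    simp [hP, hi]

open Classical in
/-- If all subfamilies of size `q` have joint exponential tails, then the sum of squares of the
family is of the order of its size with probability `1 - exp (-q)`, up to the event that some
member exceeds the top level. -/
theorem wexp_sum_sq_le (hw : w ∈ stdSimplex ℝ α) (e : (ι → α) → κ → ℝ) (S : Finset κ)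
    {θ : ℝ} {L q : ℕ} (hθ : 0 ≤ θ) (hq : 1 ≤ q) (hqS : q ≤ #S) (τ : ℕ → ℝ) (hτ : ∀ m, 0 ≤ τ m)
    (hτθ : ∀ m, τ m ^ 2 = m * θ)
    (hjoint : ∀ I ⊆ S, #I = q → ∀ (t : κ → ℕ) (σ : κ → ℤˣ), (∀ i, t i ≤ L) →
      wexp w (fun G => if ∀ i ∈ I, t i = 0 ∨ τ (t i) < ((σ i : ℤ) : ℝ) * e G i
        then (1 : ℝ) else 0) ≤ Real.exp (-(2 * ∑ i ∈ I, (t i : ℝ))))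
    {η : ℝ} (htop : ∀ i ∈ S,
      wexp w (fun G => if τ (L + 1) < |e G i| then (1 : ℝ) else 0) ≤ η) :
    wexp w (fun G => if 4 * #S * θ < ∑ i ∈ S, e G i ^ 2 then (1 : ℝ) else 0) ≤
      Real.exp (-q) + #S * η := by
  have hS : (0 : ℝ) < #S := by exact_mod_cast (by omega : 0 < #S)
  have hch : (0 : ℝ) < (#S).choose q := by exact_mod_cast Nat.choose_pos hqS
  set B : (ι → α) → ℝ := fun G => Real.exp (-(3 * q)) *
    ∑ I ∈ S.powersetCard q, 1 / ((#S).choose q : ℝ) *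
      Real.exp (∑ i ∈ I, (level θ L (e G i) : ℝ)) with hB
  have hB0 : ∀ G, 0 ≤ B G := fun G =>
    mul_nonneg (Real.exp_pos _).le (sum_nonneg fun I _ => by positivity)
  have key : ∀ G, (if 4 * #S * θ < ∑ i ∈ S, e G i ^ 2 then (1 : ℝ) else 0) ≤
      B G + ∑ i ∈ S, if τ (L + 1) < |e G i| then (1 : ℝ) else 0 := by
    intro G
    have hnn : ∀ i ∈ S, (0 : ℝ) ≤ if τ (L + 1) < |e G i| then (1 : ℝ) else 0 :=
      fun i _ => by split_ifs <;> norm_num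
    split_ifs with h
    · by_cases hbad : ∃ i ∈ S, τ (L + 1) < |e G i|
      · obtain ⟨i, hi, hlt⟩ := hbad
        have h1 := single_le_sum hnn hi
        simp only [hlt, if_true] at h1
        linarith [hB0 G]
      · push Not at hbad
        have h1 : ∀ i ∈ S, e G i ^ 2 ≤ (level θ L (e G i) + 1) * θ := by
          intro i hi
          refine sq_le_of_level θ L _ ?_
          have h2 := hτθ (L + 1)
          push_cast at h2
          rw [← h2, ← sq_abs]
          exact pow_le_pow_left₀ (abs_nonneg _) (hbad i hi) 2
        have h2 := sum_le_sum h1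
        rw [← sum_mul, sum_add_distrib] at h2
        simp only [sum_const, nsmul_eq_mul, mul_one] at h2
        have h3 : 3 * (#S : ℝ) ≤ ∑ i ∈ S, (level θ L (e G i) : ℝ) := by
          by_contra hcon
          push Not at hcon
          have : (∑ i ∈ S, (level θ L (e G i) : ℝ) + #S) * θ ≤ 4 * #S * θ :=
            mul_le_mul_of_nonneg_right (by linarith) hθ
          linarith
        have h4 := exp_average_le S (fun i => (level θ L (e G i) : ℝ)) hq hqS
        have h5 : 3 * (q : ℝ) ≤ q / #S * ∑ i ∈ S, (level θ L (e G i) : ℝ) := by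
          have := mul_le_mul_of_nonneg_left h3 (show (0 : ℝ) ≤ q / #S by positivity)
          have h6 : (q / #S * (3 * #S) : ℝ) = 3 * q := by field_simp
          linarith
        have h7 : 1 ≤ B G := by
          calc (1 : ℝ) = Real.exp (-(3 * q)) * Real.exp (3 * q) := by
                rw [← Real.exp_add]; simp
            _ ≤ B G := mul_le_mul_of_nonneg_left ((Real.exp_le_exp.2 h5).trans h4)
                (Real.exp_pos _).le
        linarith [sum_nonneg hnn]
    · exact add_nonneg (hB0 G) (sum_nonneg hnn)
  refine (wexp_mono hw.1 fun G _ => key G).trans ?_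
  rw [wexp_add, wexp_sum]
  refine add_le_add ?_ ((sum_le_sum htop).trans_eq (by simp))
  simp only [hB]
  rw [wexp_const_mul, wexp_sum]
  simp only [wexp_const_mul]
  have hmom : ∀ I ∈ S.powersetCard q,
      1 / ((#S).choose q : ℝ) * wexp w (fun G => Real.exp (∑ i ∈ I, (level θ L (e G i) : ℝ))) ≤
        1 / ((#S).choose q : ℝ) * 4 ^ q := by
    intro I hI
    obtain ⟨hIS, hIq⟩ := mem_powersetCard.1 hI
    refine mul_le_mul_of_nonneg_left ?_ (by positivity)
    rw [← hIq]
    exact wexp_exp_level_le hw e I τ hτ hτθ (hjoint I hIS hIq)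
  refine (mul_le_mul_of_nonneg_left (sum_le_sum hmom) (Real.exp_pos _).le).trans ?_
  rw [sum_const, card_powersetCard, nsmul_eq_mul]
  have h1 : ((#S).choose q : ℝ) * (1 / ((#S).choose q : ℝ) * 4 ^ q) = 4 ^ q := by field_simp
  have h2 : (4 : ℝ) ^ q ≤ Real.exp (2 * q) := by
    rw [mul_comm, Real.exp_nat_mul]
    refine pow_le_pow_left₀ (by norm_num) ?_ q
    have h3 : Real.exp 2 = Real.exp 1 * Real.exp 1 := by rw [← Real.exp_add]; norm_num
    have h4 := Real.add_one_le_exp (1 : ℝ)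
    rw [h3]
    nlinarith
  rw [h1]
  refine (mul_le_mul_of_nonneg_left h2 (Real.exp_pos _).le).trans_eq ?_
  rw [← Real.exp_add]
  congr 1
  ring

end

/-! ### The sketch in terms of rows -/

/-- The hash functions with given hash values, sorted by rows. -/
def toHashes {R n C : ℕ} (G : Fin R → Fin n → Fin C × ℤˣ) : Hashes R n C :=
  (fun u i => (G u i).1, fun u i => (G u i).2)

theorem toHashes_bijective {R n C : ℕ} :
    Function.Bijective (toHashes : (Fin R → Fin n → Fin C × ℤˣ) → Hashes R n C) :=
  Function.bijective_iff_has_inverse.2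
    ⟨fun ω u i => (ω.1 u i, ω.2 u i), fun _ => rfl, fun _ => rfl⟩

open Classical in
theorem hashMeasure_real_eq_wexp {R n C : ℕ} (p : Hashes R n C → Prop) :
    (hashMeasure R n C).real {ω | p ω} =
      wexp (rowLaw n C) fun G : Fin R → Fin n → Fin C × ℤˣ => if p (toHashes G) then 1 else 0 := by
  have h1 : (hashMeasure R n C).real {ω | p ω} =
      #{ω : Hashes R n C | p ω} / Fintype.card (Hashes R n C) := by
    rw [MeasureTheory.measureReal_def, hashMeasure, ProbabilityTheory.uniformOn_univ,
      ← coe_filter_univ, MeasureTheory.Measure.count_apply_finset]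
    simp
  have h2 : #{ω : Hashes R n C | p ω} =
      #{G : Fin R → Fin n → Fin C × ℤˣ | p (toHashes G)} := by
    rw [← card_image_of_injective _ (toHashes_bijective (R := R) (n := n) (C := C)).injective]
    congr 1
    ext ω
    simp only [mem_filter, mem_univ, true_and, mem_image]
    constructor
    · intro h
      obtain ⟨G, rfl⟩ := toHashes_bijective.surjective ω
      exact ⟨G, h, rfl⟩
    · rintro ⟨G, h, rfl⟩
      exact h
  have h3 : Fintype.card (Hashes R n C) = ((2 * C) ^ n) ^ R := by
    rw [← Fintype.card_of_bijective (toHashes_bijective (R := R) (n := n) (C := C))]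
    simp [mul_comm]
  rw [h1, h2, h3, wexp]
  simp only [rowLaw, letterLaw_apply, prod_const, card_univ, Fintype.card_fin]
  rw [← mul_sum, sum_boole]
  push_cast
  rw [one_div, inv_pow, inv_pow, div_eq_inv_mul]

theorem estimate_toHashes_sub {R n C : ℕ} (x : EuclideanSpace ℝ (Fin n)) (i : Fin n)
    (G : Fin R → Fin n → Fin C × ℤˣ) :
    estimate (toHashes G) x i - x i = medianError (fun j => x j) i G := by
  have h : ∀ u, (((toHashes G).2 u i : ℤ) : ℝ) * sketch (toHashes G) x u ((toHashes G).1 u i) =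
      x i + rowNoise (fun j => x j) i (G u) := by
    intro u
    have h1 : sketch (toHashes G) x u ((toHashes G).1 u i) = (((G u i).2 : ℤ) : ℝ) * x i +
        bucketSum (G u i).1 (fun j => if j = i then 0 else x j) (G u) := by
      rw [sketch, bucketSum, sum_filter]
      simp only [toHashes]
      rw [← add_sum_erase univ _ (mem_univ i), ← add_sum_erase univ _ (mem_univ i)]
      simp only [if_true, mul_zero, zero_add]
      refine congrArg _ (sum_congr rfl fun j hj => ?_)
      rw [if_neg (mem_erase.1 hj).1]
      rfl
    have h2 : (((G u i).2 : ℤ) : ℝ) * (((G u i).2 : ℤ) : ℝ) = 1 := by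
      rcases Int.units_eq_one_or (G u i).2 with hs | hs <;> simp [hs]
    rw [h1, rowNoise, mul_add, ← mul_assoc]
    simp only [toHashes]
    rw [h2, one_mul]
  simp only [estimate, medianError, h]

theorem norm_restrict_sub_sq {R n C : ℕ} (x : EuclideanSpace ℝ (Fin n)) (S : Finset (Fin n))
    (G : Fin R → Fin n → Fin C × ℤˣ) :
    ‖restrict S (estimate (toHashes G) x) - restrict S x‖ ^ 2 =
      ∑ i ∈ S, medianError (fun j => x j) i G ^ 2 := by
  rw [EuclideanSpace.norm_sq_eq, ← sum_subset (subset_univ S)]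
  · refine sum_congr rfl fun i hi => ?_
    rw [Real.norm_eq_abs, sq_abs, ← estimate_toHashes_sub]
    simp [restrict, hi]
  · intro i _ hi
    simp [restrict, hi]

theorem norm_tail_sq {n : ℕ} (x : EuclideanSpace ℝ (Fin n)) (k : ℕ) :
    ‖tail x k‖ ^ 2 = ∑ j with j ∉ (univ.filter fun i => rank x i < k), x j ^ 2 := by
  rw [EuclideanSpace.norm_sq_eq, sum_filter]
  refine sum_congr rfl fun j _ => ?_
  by_cases hj : rank x j < k <;> simp [tail, hj]

theorem card_rank_lt_le {n : ℕ} (x : EuclideanSpace ℝ (Fin n)) (k : ℕ) :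
    #(univ.filter fun i => rank x i < k) ≤ k := by
  refine (card_le_card_of_injOn (t := range k) (rank x) (fun i hi => ?_) ?_).trans_eq
    (card_range k)
  · simpa using hi
  · intro i _ j _ h
    exact (Tuple.sort fun j => -|x j|).symm.injective (Fin.ext h)

/-! ### Choice of the parameters -/

/-- The small-ball estimate at the scale `τ = ρ * a * σ`, where `σ` is a bound for the standard
deviation of a bucket and `ρ` is small. -/
theorem four_mul_le_smallBall {n C : ℕ} (x : Fin n → ℝ) (H : Finset (Fin n)) {k : ℕ} (hk : 0 < k)
    (hkC : 8 * k ≤ C) (hH : #H ≤ k) {a ρ : ℝ} (ha : 256 ≤ a) (hρ0 : 0 ≤ ρ) (hρ : ρ ≤ 1 / 64)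
    {V : Finset (Fin C)} {b : Fin C} (hb : b ∈ V) (hV : C ≤ 2 * #V) (y : Fin n → ℝ)
    (hy : ∀ j, |y j| ≤ |x j|) :
    4 * (2 * ρ) ≤ wexp (bucketLaw V) fun g =>
      if |bucketSum b y g| ≤ ρ * a * √((∑ j with j ∉ H, x j ^ 2) / C) then (1 : ℝ) else 0 := by
  rcases hρ0.eq_or_lt with rfl | hρpos
  · rw [mul_zero, mul_zero]
    exact wexp_nonneg (bucketLaw_mem ⟨b, hb⟩).1 fun g => by split_ifs <;> norm_num
  set T := ∑ j with j ∉ H, x j ^ 2 with hT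
  have hT0 : 0 ≤ T := sum_nonneg fun _ _ => sq_nonneg _
  set σ := √(T / C) with hσ
  have hσ0 : 0 ≤ σ := Real.sqrt_nonneg _
  have hρa : 0 < ρ * a := by positivity
  set N := ⌈4 / (ρ * a)⌉₊ with hN
  have hN1 : 1 ≤ N := Nat.one_le_iff_ne_zero.2 (Nat.ceil_pos.2 (by positivity)).ne'
  have hNpos : (0 : ℝ) < N := by exact_mod_cast hN1
  have hCr : (0 : ℝ) < C := by exact_mod_cast (by omega : 0 < C)
  have hVr : (C : ℝ) ≤ 2 * #V := by exact_mod_cast hV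
  have hvar : 1 / (2 * #V) * ∑ j with j ∉ H, y j ^ 2 ≤ σ ^ 2 := by
    rw [hσ, Real.sq_sqrt (by positivity), div_eq_inv_mul T]
    refine mul_le_mul ?_ (sum_le_sum fun j _ => sq_le_sq.2 (hy j))
      (sum_nonneg fun _ _ => sq_nonneg _) (by positivity)
    rw [one_div]
    exact inv_anti₀ hCr hVr
  have hscale : 4 * σ ≤ ρ * a * σ * N := by
    have h1 : 4 ≤ N * (ρ * a) := by
      rw [← div_le_iff₀ hρa]
      exact Nat.le_ceil _
    nlinarith
  refine le_trans ?_ (smallBall hb (by omega) y H (by omega) hσ0 hN1 hvar hscale)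
  rw [le_div_iff₀ (by positivity)]
  have h2 : (N : ℝ) < 4 / (ρ * a) + 1 := Nat.ceil_lt_add_one (by positivity)
  have h3 : ρ * (4 / (ρ * a)) ≤ 1 / 64 := by
    have : ρ * (4 / (ρ * a)) = 4 / a := by field_simp
    rw [this, div_le_div_iff₀ (by linarith) (by norm_num)]
    linarith
  nlinarith

/-- The bound for fixed parameters. Here `q` is the size of the subfamilies for which joint tail
bounds are used. With `σ` the standard deviation of a bucket, squared errors are measured in units
of `(a * σ) ^ 2 / R`, and they are resolved up to `r ^ 2 * R` units; an error beyond that, that is,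
above `a * r * σ`, occurs in one row with probability at most `β ^ 2`. -/
theorem hashMeasure_real_le {R n C k q : ℕ} (hR : 0 < R) (hk : 0 < k) (x : EuclideanSpace ℝ (Fin n))
    (S : Finset (Fin n)) (hSk : #S ≤ k) (hq : 1 ≤ q) (hqS : q ≤ #S) {a β r : ℝ}
    (ha : 256 ≤ a) (hβ0 : 0 < β) (hβ1 : β ≤ 1) (hr0 : 0 < r) (hr : r ≤ 1 / 64)
    (har : 2 / β ≤ a * r) (hCa : 4 * a ^ 2 * k ≤ C) (hCβ : 2 / β ^ 2 * k ≤ C)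
    (hqC : (q : ℝ) ^ 2 * (q + 2) * Real.exp (2 * q * (2 * r)) ≤ C) :
    (hashMeasure R n C).real
        {ω | ‖restrict S (estimate ω x) - restrict S x‖ ^ 2 >
          (#S : ℝ) * (1 / (R : ℝ)) * (‖tail x k‖ ^ 2 / (k : ℝ))} ≤
      Real.exp (-q) + #S * (2 * β) ^ R := by
  classical
  have hRr : (0 : ℝ) < R := by exact_mod_cast hR
  have hkr : (0 : ℝ) < k := by exact_mod_cast hk
  have h8 : 8 * k ≤ C := by
    have h1 : (8 : ℝ) ≤ 4 * a ^ 2 := by nlinarith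
    have : (8 : ℝ) * k ≤ C := (mul_le_mul_of_nonneg_right h1 hkr.le).trans hCa
    exact_mod_cast this
  have hC : 0 < C := by omega
  have hCr : (0 : ℝ) < C := by exact_mod_cast hC
  set H : Finset (Fin n) := univ.filter fun i => rank x i < k with hH
  have hHk : #H ≤ k := card_rank_lt_le x k
  set X : Fin n → ℝ := fun j => x j with hX
  set T := ∑ j with j ∉ H, X j ^ 2 with hT
  have hT0 : 0 ≤ T := sum_nonneg fun _ _ => sq_nonneg _
  have htail : ‖tail x k‖ ^ 2 = T := norm_tail_sq x k
  set τ : ℕ → ℝ := fun m => √(m / R) * a * √(T / C) with hτ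
  set θ : ℝ := a ^ 2 * (T / C) / R with hθ
  have hθ0 : 0 ≤ θ := by positivity
  have hτ0 : ∀ m, 0 ≤ τ m := fun m => by simp only [hτ]; positivity
  have hτθ : ∀ m, τ m ^ 2 = m * θ := fun m => by
    simp only [hτ, hθ]
    rw [mul_pow, mul_pow, Real.sq_sqrt (by positivity), Real.sq_sqrt (by positivity)]
    ring
  set L := ⌊r ^ 2 * R⌋₊ with hL
  have hLr : ∀ m ≤ L, √((m : ℝ) / R) ≤ r := by
    intro m hm
    refine Real.sqrt_le_iff.2 ⟨hr0.le, ?_⟩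
    rw [div_le_iff₀ hRr]
    exact (Nat.cast_le.2 hm).trans (Nat.floor_le (by positivity))
  rw [hashMeasure_real_eq_wexp]
  have hmain := wexp_sum_sq_le (rowLaw_mem (n := n) hC)
    (fun (G : Fin R → Fin n → Fin C × ℤˣ) i => medianError X i G) S (L := L) hθ0 hq hqS τ hτ0 hτθ
    (η := (2 * β) ^ R) ?_ ?_
  · refine le_trans (wexp_mono (rowLaw_mem hC).1 fun G _ => ?_) hmain
    rw [norm_restrict_sub_sq, htail]
    -- this is where a large `c` is used: `4 * a ^ 2 * k ≤ C`
    have hle : 4 * (#S : ℝ) * θ ≤ #S * (1 / R) * (T / k) := by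
      have h1 : 4 * (#S : ℝ) * θ = #S * (1 / R) * (4 * a ^ 2 * (T / C)) := by
        rw [hθ]; ring
      rw [h1]
      refine mul_le_mul_of_nonneg_left ?_ (by positivity)
      rw [← mul_div_assoc, div_le_div_iff₀ hCr hkr]
      nlinarith [mul_le_mul_of_nonneg_left hCa hT0]
    split_ifs with h1 h2
    · exact le_rfl
    · exact absurd (hle.trans_lt h1) h2
    · norm_num
    · exact le_rfl
  · intro I hIS hIq t σ ht
    have hlaw := (rowLaw_mem (n := n) hC).1
    refine le_trans (wexp_mono hlaw fun G _ => ?_)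
      ((wexp_joint_le (R := R) hC X I (fun i => 2 * √((t i : ℝ) / R)) (fun i => τ (t i)) σ
        (u := 2 * r) (fun i => by positivity)
        (fun i => by linarith [hLr (t i) (ht i)]) (by linarith) (fun i => hτ0 _) (by omega)
        (by rw [hIq]; exact hqC)
        (fun i _ V b hb hV y hy => four_mul_le_smallBall X H hk h8 hHk ha (Real.sqrt_nonneg _)
          ((hLr (t i) (ht i)).trans hr) hb hV y hy)).trans_eq ?_)
    · split_ifs with h1 h2
      · exact le_rfl
      · refine absurd (fun i hi => ?_) h2
        exact (h1 i hi).imp (fun h0 => by simp [h0]) id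
      · norm_num
      · exact le_rfl
    · congr 1
      have h1 : ∀ i ∈ I, (2 * √((t i : ℝ) / R)) ^ 2 = 4 / R * t i := fun i _ => by
        rw [mul_pow, Real.sq_sqrt (by positivity)]
        ring
      rw [sum_congr rfl h1, ← mul_sum]
      field_simp
      ring
  · intro i _
    refine wexp_medianError_le hC X i hβ0 hβ1 ?_
    have hlev : r ^ 2 ≤ ((L + 1 : ℕ) : ℝ) / R := by
      rw [le_div_iff₀ hRr]
      push_cast
      exact (Nat.lt_floor_add_one _).le
    have hTle : T ≤ β ^ 2 / 2 * C * τ (L + 1) ^ 2 := by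
      have h1 : β ^ 2 / 2 * C * τ (L + 1) ^ 2 = β ^ 2 / 2 * a ^ 2 * (((L + 1 : ℕ) : ℝ) / R) * T := by
        rw [hτθ, hθ]
        field_simp
      have h2 : 2 ≤ a * r * β := by
        rw [← div_le_iff₀ hβ0]; exact har
      have h3 : 4 ≤ β ^ 2 * a ^ 2 * r ^ 2 := by nlinarith
      have h4 : β ^ 2 * a ^ 2 * r ^ 2 ≤ β ^ 2 * a ^ 2 * (((L + 1 : ℕ) : ℝ) / R) :=
        mul_le_mul_of_nonneg_left hlev (by positivity)
      rw [h1]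
      have h5 : 1 ≤ β ^ 2 / 2 * a ^ 2 * (((L + 1 : ℕ) : ℝ) / R) := by linarith
      nlinarith
    refine (wexp_rowNoise_le hC X i H (hτ0 _) (by positivity) hTle).trans ?_
    have h6 : (#H : ℝ) / C ≤ β ^ 2 / 2 := by
      rw [div_le_iff₀ hCr]
      have h7 : (#H : ℝ) ≤ k := by exact_mod_cast hHk
      have h8 : β ^ 2 / 2 * (2 / β ^ 2 * k) ≤ β ^ 2 / 2 * C :=
        mul_le_mul_of_nonneg_left hCβ (by positivity)
      have h9 : β ^ 2 / 2 * (2 / β ^ 2 * k) = k := by field_simp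
      linarith
    linarith

/-- Subfamilies of logarithmic size `q` are small enough for collisions to be negligible. -/
theorem log_size_bounds {D : ℝ} (hD : 1 ≤ D) {N q : ℕ} (hN : 128 * (D + 3) ≤ Real.log N)
    (hq : q = ⌈D * Real.log N⌉₊) :
    1 ≤ q ∧ q ≤ N ∧ (q : ℝ) ^ 2 * (q + 2) * Real.exp (2 * q * (2 * (1 / (64 * D)))) ≤ N := by
  set X := Real.log N with hX
  have hX0 : 512 ≤ X := by linarith
  have hN0 : (0 : ℝ) < N := by
    rcases Nat.eq_zero_or_pos N with h | h
    · simp [hX, h] at hX0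
      linarith
    · exact_mod_cast h
  have hDX : 0 < D * X := by positivity
  have hqlt : (q : ℝ) < D * X + 1 := by rw [hq]; exact Nat.ceil_lt_add_one hDX.le
  set E := Real.exp (X / 8) with hE
  have hE1 : D * X + 3 ≤ E := by
    have := Real.quadratic_le_exp_of_nonneg (x := X / 8) (by linarith)
    nlinarith
  have hEN : E ^ 4 ≤ N := by
    rw [hE, ← Real.exp_nat_mul, ← Real.exp_log hN0]
    refine Real.exp_le_exp.2 ?_
    push_cast
    linarith
  have hE0 : 1 ≤ E := by linarith
  have hEpow : E ≤ E ^ 4 := le_self_pow₀ hE0 (by norm_num)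
  refine ⟨?_, ?_, ?_⟩
  · rw [hq]; exact Nat.one_le_iff_ne_zero.2 (Nat.ceil_pos.2 hDX).ne'
  · have : (q : ℝ) ≤ N := by linarith
    exact_mod_cast this
  · have hexp : Real.exp (2 * q * (2 * (1 / (64 * D)))) ≤ E := by
      refine Real.exp_le_exp.2 ?_
      have h1 : (2 * q * (2 * (1 / (64 * D))) : ℝ) = q / (16 * D) := by field_simp; ring
      rw [h1, div_le_iff₀ (by positivity)]
      nlinarith
    have hqE : (q : ℝ) ^ 2 ≤ E ^ 2 := pow_le_pow_left₀ (Nat.cast_nonneg _) (by linarith) 2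
    calc (q : ℝ) ^ 2 * (q + 2) * Real.exp (2 * q * (2 * (1 / (64 * D)))) ≤ E ^ 2 * E * E := by
          refine mul_le_mul (mul_le_mul hqE (by linarith) (by positivity) (by positivity)) hexp
            (Real.exp_pos _).le (by positivity)
      _ = E ^ 4 := by ring
      _ ≤ N := hEN

end CountSketch

theorem mainTheorem2 (d A : ℝ) (hA : 0 < A) :
    ∃ c₀ K : ℝ, 0 < c₀ ∧ 0 < K ∧
      ∀ (c : ℝ) (n k R C : ℕ), c₀ ≤ c → 0 < k → 0 < R → A * Real.log k ≤ R → (C : ℝ) = c * k →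
        ∀ (x : EuclideanSpace ℝ (Fin n)) (S : Finset (Fin n)), S.card ≤ k →
          (CountSketch.hashMeasure R n C).real
              {ω | ‖CountSketch.restrict S (CountSketch.estimate ω x) -
                      CountSketch.restrict S x‖ ^ 2 >
                    (S.card : ℝ) * (1 / (R : ℝ)) * (‖CountSketch.tail x k‖ ^ 2 / (k : ℝ))}
            ≤ K / (S.card : ℝ) ^ d := by
  set D : ℝ := max d 1 with hD
  have hD1 : 1 ≤ D := le_max_right _ _
  have hdD : d ≤ D := le_max_left _ _
  -- `(2 * β) ^ R ≤ k ^ (-(D + 1))` as soon as `A * log k ≤ R`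
  set β : ℝ := Real.exp (-((D + 1) / A)) / 2 with hβ
  have hβ0 : 0 < β := by positivity
  have hβ1 : β ≤ 1 := by
    have : Real.exp (-((D + 1) / A)) ≤ 1 := Real.exp_le_one_iff.2 (by
      have : 0 ≤ (D + 1) / A := by positivity
      linarith)
    linarith
  -- levels are resolved up to `r ^ 2 * R`; `a` is the threshold scale in standard deviations
  set r : ℝ := 1 / (64 * D) with hr
  have hr0 : 0 < r := by positivity
  have hr1 : r ≤ 1 / 64 := by
    rw [hr, div_le_div_iff₀ (by positivity) (by norm_num)]
    linarith
  set a : ℝ := 256 + 2 / β / r with ha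
  have ha0 : 256 ≤ a := by
    have : 0 ≤ 2 / β / r := by positivity
    linarith
  have har : 2 / β ≤ a * r := by
    have : 2 / β / r * r = 2 / β := by field_simp
    rw [ha, add_mul, this]
    nlinarith
  set N₀ : ℝ := Real.exp (128 * (D + 3)) with hN₀
  have hN₀pos : 0 < N₀ := Real.exp_pos _
  refine ⟨4 * a ^ 2 + 2 / β ^ 2, N₀ ^ D + 2, by positivity, by positivity, ?_⟩
  intro c n k R C hc hk hR hRk hC x S hSk
  have hkr : (0 : ℝ) < k := by exact_mod_cast hk
  have hCa : 4 * a ^ 2 * k ≤ C := by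
    rw [hC]
    have : 0 ≤ 2 / β ^ 2 := by positivity
    exact mul_le_mul_of_nonneg_right (by linarith) hkr.le
  have hCβ : 2 / β ^ 2 * k ≤ C := by
    rw [hC]
    have : 0 ≤ 4 * a ^ 2 := by positivity
    exact mul_le_mul_of_nonneg_right (by linarith) hkr.le
  have hK0 : 0 ≤ N₀ ^ D := by positivity
  rcases S.eq_empty_or_nonempty with rfl | hS
  · have : {ω : CountSketch.Hashes R n C |
        ‖CountSketch.restrict ∅ (CountSketch.estimate ω x) - CountSketch.restrict ∅ x‖ ^ 2 >
          ((∅ : Finset (Fin n)).card : ℝ) * (1 / (R : ℝ)) *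
            (‖CountSketch.tail x k‖ ^ 2 / (k : ℝ))} = ∅ := by
      ext ω
      simp [CountSketch.restrict]
    rw [this, MeasureTheory.measureReal_empty]
    positivity
  have hS1 : (1 : ℝ) ≤ S.card := by exact_mod_cast hS.card_pos
  have hSr : (0 : ℝ) < S.card := by linarith
  have hpow : (S.card : ℝ) ^ d ≤ (S.card : ℝ) ^ D := Real.rpow_le_rpow_of_exponent_le hS1 hdD
  have hpow0 : 0 < (S.card : ℝ) ^ d := Real.rpow_pos_of_pos hSr d
  have hSkr : (S.card : ℝ) ≤ k := by exact_mod_cast hSk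
  rcases le_or_gt (128 * (D + 3)) (Real.log S.card) with hlarge | hsmall
  · obtain ⟨hq1, hqS, hqN⟩ := CountSketch.log_size_bounds hD1 hlarge rfl
    set q := ⌈D * Real.log S.card⌉₊ with hq
    have hkC : (k : ℝ) ≤ C := by
      have h1 : (1 : ℝ) ≤ 4 * a ^ 2 := by nlinarith
      linarith [mul_le_mul_of_nonneg_right h1 hkr.le]
    have h := CountSketch.hashMeasure_real_le hR hk x S hSk hq1 hqS ha0 hβ0 hβ1 hr0 hr1 har hCa hCβ
      (hqN.trans (hSkr.trans hkC))
    refine h.trans ?_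
    have h1 : Real.exp (-q) ≤ 1 / (S.card : ℝ) ^ D := by
      rw [Real.rpow_def_of_pos hSr, one_div, ← Real.exp_neg]
      refine Real.exp_le_exp.2 ?_
      have := Nat.le_ceil (D * Real.log S.card)
      rw [mul_comm (Real.log _)]
      linarith
    have h2 : S.card * (2 * β) ^ R ≤ 1 / (S.card : ℝ) ^ D := by
      have h3 : (2 * β) ^ R ≤ Real.exp (-((D + 1) * Real.log S.card)) := by
        have h4 : 2 * β = Real.exp (-((D + 1) / A)) := by rw [hβ]; ring
        rw [h4, ← Real.exp_nat_mul]
        refine Real.exp_le_exp.2 ?_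
        have h5 : Real.log S.card ≤ Real.log k := Real.log_le_log hSr hSkr
        have h6 : A * Real.log S.card ≤ R := (mul_le_mul_of_nonneg_left h5 hA.le).trans hRk
        have h7 : Real.log S.card ≤ R / A := by
          rw [le_div_iff₀ hA]; linarith
        have h8 := mul_le_mul_of_nonneg_left h7 (show 0 ≤ D + 1 by linarith)
        have h9 : (R : ℝ) * -((D + 1) / A) = -((D + 1) * (R / A)) := by ring
        rw [h9]
        linarith
      refine (mul_le_mul_of_nonneg_left h3 hSr.le).trans_eq ?_
      rw [Real.rpow_def_of_pos hSr, one_div, ← Real.exp_neg]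
      nth_rewrite 1 [← Real.exp_log hSr]
      rw [← Real.exp_add]
      congr 1
      ring
    have h3 : 1 / (S.card : ℝ) ^ D ≤ 1 / (S.card : ℝ) ^ d := one_div_le_one_div_of_le hpow0 hpow
    have h4 : (N₀ ^ D + 2) / (S.card : ℝ) ^ d = N₀ ^ D / (S.card : ℝ) ^ d +
        (1 / (S.card : ℝ) ^ d + 1 / (S.card : ℝ) ^ d) := by ring
    rw [h4]
    have h5 : 0 ≤ N₀ ^ D / (S.card : ℝ) ^ d := by positivity
    linarith
  · -- small `S`: the bound exceeds `1`
    have hCpos : 0 < C := by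
      have : (0 : ℝ) < C := lt_of_lt_of_le (by positivity) hCa
      exact_mod_cast this
    have := CountSketch.isProbabilityMeasure_hashMeasure (R := R) (n := n) hCpos
    refine MeasureTheory.measureReal_le_one.trans ?_
    rw [one_le_div hpow0]
    have h1 : (S.card : ℝ) ≤ N₀ := by
      rw [hN₀, ← Real.exp_log hSr]
      exact Real.exp_le_exp.2 hsmall.le
    have h2 : (S.card : ℝ) ^ D ≤ N₀ ^ D := Real.rpow_le_rpow hSr.le h1 (by linarith)
    linarith
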